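/- Let $d\ge 1$, $T\ge 0$, $0<\eta\le\frac1{2d}$. Write $\langle A,B\rangle=\mathrm{tr}(A^{\mathsf T}B)$ for real $d\times d$ matrices, and for positive definite $W,U$ let $D(W\|U)=R(W)-R(U)-\langle\nabla R(U),W-U\rangle$ be the Bregman divergence of the regularizer $R(W)=-\log\det W$ (so $\nabla R(U)=-U^{-1}$). A learner and an environment interact in rounds $t=1,\dots,T$. In round $t$ the environment fixes a symmetric loss matrix $L_t$ of spectral norm at most $1$. The matrix $L_t$ may be random and may depend on the whole history $\mathcal F_t$ of the interaction before the learner's draw of round $t$ (adaptive adversary). The learner starts with $W_1=\frac1d I$ and in round $t$ proceeds as follows (online mirror descent for bandit PCA, with exploration rate $\gamma=0$ and dense sampling). 1. It takes an eigendecomposition $W_t=\sum_{i=1}^d\lambda_i u_iu_i^{\mathsf T}$ with an orthonormal basis $(u_i)$ (any choice that is measurable with respect to $\mathcal F_t$). 2. Given $\mathcal F_t$, it draws a fair coin $B\in\{0,1\}$. If $B=1$, it draws $I$ with $P(I=i)=\lambda_i$ and plays $w_t=u_I$. If $B=0$, it draws independent uniform signs $s_1,\dots,s_d\in\{-1,1\}$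 and plays $w_t=\sum_i s_i\sqrt{\lambda_i}\,u_i$. 3. It suffers and observes $\ell_t=\langle w_tw_t^{\mathsf T},L_t\rangle$, and sets $\widetilde L_t=2\ell_t W_t^{-1/2}w_tw_t^{\mathsf T}W_t^{-1/2}$ if $B=1$ and $\widetilde L_t=\ell_t\,(W_t^{-1}w_tw_t^{\mathsf T}W_t^{-1}-W_t^{-1})$ if $B=0$. 4. It sets $W_{t+1}=(W_t^{-1}+\eta\widetilde L_t+\beta I)^{-1}$, where $\beta\in\mathbb R$ is such that $W_{t+1}$ is positive definite with trace $1$. Then each update is well defined and is an online mirror descent step: $W_{t+1}$ minimizes $\eta\langle W,\widetilde L_t\rangle+D(W\|W_t)$ over positive definite $W$ with $\mathrm{tr}\,W=1$. Moreover, the maximum $$\mathrm{regret}_T=\max_{\|u\|=1}\ \sum_{t=1}^T\mathbb E\big[\langle w_tw_t^{\mathsf T}-uu^{\mathsf T},L_t\rangle\big]$$ is attained and satisfies $$\mathrm{regret}_T\le\frac{d\log T}{\eta}+\eta\,(d^2+1)\sum_{t=1}^T\mathbb E[\ell_t^2]+2$$ (with $\log 0:=0$ for $T=0$). -/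

import Mathlib

open MeasureTheory
open scoped Matrix

namespace BanditPCA

noncomputable section

/-- Real `d × d` matrices. -/
abbrev Mat (d : ℕ) : Type := Matrix (Fin d) (Fin d) ℝ

/-- The space `ℝ^d` with the Euclidean norm. -/
abbrev Vec (d : ℕ) : Type := EuclideanSpace ℝ (Fin d)

/-- The inner product `⟨A, B⟩ = tr (Aᵀ B)` of matrices. -/
def iprod {d : ℕ} (A B : Mat d) : ℝ := (Aᵀ * B).trace

/-- The rank-one matrix `w wᵀ`. -/
def outer {d : ℕ} (w : Vec d) : Mat d := Matrix.vecMulVec w.ofLp w.ofLp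

/-- The spectral norm: the operator norm of `x ↦ A x` on Euclidean space. -/
def specNorm {d : ℕ} (A : Mat d) : ℝ := ‖Matrix.toEuclideanCLM (n := Fin d) (𝕜 := ℝ) A‖

/-- Positive definite density matrices. -/
def posDensity (d : ℕ) : Set (Mat d) := {W | W.PosDef ∧ W.trace = 1}

/-- `W = ∑ i, lam i • v i (v i)ᵀ` with `v` an orthonormal basis of `ℝ^d`. -/
def IsEigendecomposition {d : ℕ} (W : Mat d) (lam : Fin d → ℝ) (v : Fin d → Vec d) : Prop :=
  Orthonormal ℝ v ∧ W = ∑ i, lam i • outer (v i)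

/-! ### The regularizer and mirror descent -/

/-- The regularizer `R(W) = - log det W` (used at positive definite matrices only). -/
def negLogDet {d : ℕ} (W : Mat d) : ℝ := -Real.log W.det

/-- The Bregman divergence `R(W) - R(U) - ⟨∇R(U), W - U⟩` of `R = - log det`,
where `∇R(U) = - U⁻¹` (used at positive definite matrices only). -/
def bregman {d : ℕ} (W U : Mat d) : ℝ :=
  negLogDet W - negLogDet U - iprod (-U⁻¹) (W - U)

/-- `W'` minimizes `η ⟨V, G⟩ + D_R(V ‖ W)` over density matrices `V`. The objective is `+∞` at
singular matrices, so that positive definite `V` are the only competitors. -/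
def IsMirrorDescentStep {d : ℕ} (η : ℝ) (W G W' : Mat d) : Prop :=
  W' ∈ posDensity d ∧ IsMinOn (fun V => η * iprod V G + bregman V W) (posDensity d) W'

/-- `W' = (W⁻¹ + η G + β I)⁻¹` for some real `β`, with `W'` a positive definite matrix of
trace one. -/
def IsUpdate {d : ℕ} (η : ℝ) (W G W' : Mat d) : Prop :=
  W' ∈ posDensity d ∧ ∃ β : ℝ, W' = (W⁻¹ + η • G + β • (1 : Mat d))⁻¹

/-- The update of the algorithm: the matrix `W'` with `IsUpdate η W G W'`. -/
def update {d : ℕ} (η : ℝ) (W G : Mat d) : Mat d := Classical.epsilon (IsUpdate η W G)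

/-! ### Dense sampling -/

/-- The random draw of the dense sampling method: `Sum.inl i` stands for `B = 1` and `I = i`,
and `Sum.inr s` stands for `B = 0` with the sign vector `s ∈ {-1, 1}^d`. -/
abbrev DenseDraw (d : ℕ) : Type := Fin d ⊕ (Fin d → ℤˣ)

/-- The law of the draw: `B` is a fair coin; if `B = 1` then `I = i` with probability `lam i`;
if `B = 0` then the `d` signs are independent and uniform. -/
def denseLaw {d : ℕ} (lam : Fin d → ℝ) : DenseDraw d → ℝ
  | Sum.inl i => 1 / 2 * lam i
  | Sum.inr _ => 1 / 2 * (1 / 2) ^ d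

/-- The vector that is played: `v I` if `B = 1`, and `∑ i, s i √(lam i) v i` if `B = 0`. -/
def denseVector {d : ℕ} (lam : Fin d → ℝ) (v : Fin d → Vec d) : DenseDraw d → Vec d
  | Sum.inl i => v i
  | Sum.inr s => ∑ i, (((s i : ℤ) : ℝ) * Real.sqrt (lam i)) • v i

/-- The matrix `∑ i, lam i • v i (v i)ᵀ`. -/
def ofEigen {d : ℕ} (lam : Fin d → ℝ) (v : Fin d → Vec d) : Mat d := ∑ i, lam i • outer (v i)

/-- For `W = ∑ i, lam i • v i (v i)ᵀ`, the matrix `W^(-1/2)`. -/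
def invSqrtOfEigen {d : ℕ} (lam : Fin d → ℝ) (v : Fin d → Vec d) : Mat d :=
  ∑ i, (Real.sqrt (lam i))⁻¹ • outer (v i)

/-- The loss estimate of the dense sampling method, for the observed loss `l` and
`W = ∑ i, lam i • v i (v i)ᵀ`: it is `2 l W^(-1/2) w wᵀ W^(-1/2)` if `B = 1`, and
`l (W⁻¹ w wᵀ W⁻¹ - W⁻¹)` if `B = 0`, where `w` is the vector that was played. -/
def denseEstimate {d : ℕ} (lam : Fin d → ℝ) (v : Fin d → Vec d) (o : DenseDraw d) (l : ℝ) :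
    Mat d :=
  match o with
  | Sum.inl _ =>
      (2 * l) • (invSqrtOfEigen lam v * outer (denseVector lam v o) * invSqrtOfEigen lam v)
  | Sum.inr _ =>
      l • ((ofEigen lam v)⁻¹ * outer (denseVector lam v o) * (ofEigen lam v)⁻¹
        - (ofEigen lam v)⁻¹)

/-! ### The interaction. Rounds are numbered `0, 1, 2, …`. -/

/-- What is chosen or drawn in the rounds of the game, as random variables on `Ω`: the loss
matrices of the environment, the eigendecompositions used by the learner (any choice of
eigenvectors is allowed), and the random draws of the learner. -/
structure Play (d : ℕ) (Ω : Type*) where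
  loss : ℕ → Ω → Mat d
  eigval : ℕ → Ω → Fin d → ℝ
  eigvec : ℕ → Ω → Fin d → Vec d
  draw : ℕ → Ω → DenseDraw d

namespace Play

variable {d : ℕ} {Ω : Type*}

/-- The sampling weights `(1 - γ) μ + γ (1/d, …, 1/d)`. -/
def weights (X : Play d Ω) (γ : ℝ) (t : ℕ) (ω : Ω) : Fin d → ℝ :=
  fun i => (1 - γ) * X.eigval t ω i + γ * (1 / (d : ℝ))

/-- The vector `w_t` played by the learner. -/
def action (X : Play d Ω) (γ : ℝ) (t : ℕ) (ω : Ω) : Vec d :=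
  denseVector (X.weights γ t ω) (X.eigvec t ω) (X.draw t ω)

/-- The observed loss `ℓ_t = ⟨w_t w_tᵀ, L_t⟩`. -/
def observed (X : Play d Ω) (γ : ℝ) (t : ℕ) (ω : Ω) : ℝ :=
  iprod (outer (X.action γ t ω)) (X.loss t ω)

/-- The estimate of the loss matrix `L_t`. -/
def estimate (X : Play d Ω) (γ : ℝ) (t : ℕ) (ω : Ω) : Mat d :=
  denseEstimate (X.weights γ t ω) (X.eigvec t ω) (X.draw t ω) (X.observed γ t ω)

/-- The density matrices `W_t` of the algorithm with learning rate `η` and exploration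
rate `γ`, started at `I / d`. -/
def iterate (X : Play d Ω) (η γ : ℝ) : ℕ → Ω → Mat d
  | 0, _ => (1 / (d : ℝ)) • (1 : Mat d)
  | t + 1, ω => update η (X.iterate η γ t ω) (X.estimate γ t ω)

/-- `X` is a run over `T` rounds of the algorithm with dense sampling against an adaptive
environment. The σ-algebra `𝓕 t` describes the interaction history up to the moment in round `t`
at which the loss matrix is fixed and the learner has not yet drawn its action; it may also
contain further randomness of the environment. -/
structure IsRun [mΩ : MeasurableSpace Ω] (X : Play d Ω) (P : Measure Ω)
    (𝓕 : Filtration ℕ mΩ) (T : ℕ) (η γ : ℝ) : Prop where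
  /-- The loss matrices are symmetric, -/
  loss_symm : ∀ t < T, ∀ ω, (X.loss t ω).IsSymm
  /-- have spectral norm at most one, -/
  loss_norm : ∀ t < T, ∀ ω, specNorm (X.loss t ω) ≤ 1
  /-- and may depend on the whole history, except the current action. -/
  loss_meas : ∀ t < T, ∀ i j, Measurable[𝓕 t] fun ω => X.loss t ω i j
  /-- In every round the learner eigendecomposes its current density matrix, -/
  eigen : ∀ t < T, ∀ ω,
    IsEigendecomposition (X.iterate η γ t ω) (X.eigval t ω) (X.eigvec t ω)
  eigval_meas : ∀ t < T, ∀ i, Measurable[𝓕 t] fun ω => X.eigval t ω i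
  eigvec_meas : ∀ t < T, ∀ i j, Measurable[𝓕 t] fun ω => X.eigvec t ω i j
  /-- and makes a fresh draw, which then belongs to the history, -/
  draw_meas : ∀ t < T, ∀ o, MeasurableSet[𝓕 (t + 1)] {ω | X.draw t ω = o}
  /-- with the conditional law, given the history, of the dense sampling method. -/
  draw_law : ∀ t < T, ∀ o,
    P[Set.indicator {ω | X.draw t ω = o} (fun _ => (1 : ℝ)) | 𝓕 t]
      =ᵐ[P] fun ω => denseLaw (X.weights γ t ω) o

/-- The expected regret against the fixed vector `x` over `T` rounds. -/
def regretAgainst [MeasurableSpace Ω] (X : Play d Ω) (P : Measure Ω) (γ : ℝ) (T : ℕ)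
    (x : Vec d) : ℝ :=
  ∑ t ∈ Finset.range T, ∫ ω, iprod (outer (X.action γ t ω) - outer x) (X.loss t ω) ∂P

/-- The regret: the largest expected regret against a unit vector. -/
def regret [MeasurableSpace Ω] (X : Play d Ω) (P : Measure Ω) (γ : ℝ) (T : ℕ) : ℝ :=
  sSup (X.regretAgainst P γ T '' {x | ‖x‖ = 1})

end Play

end

end BanditPCA

/-! Write `W`, `G`, `W'` for the iterate, the loss estimate and the next iterate, and `N = W⁻¹ + η
G`, so that `W'⁻¹ = N + β I`. On trace-one matrices the mirror descent objective differs from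
`bregman · W'` by a constant, which makes `W'` its minimizer (`IsUpdate.isMirrorDescentStep`). The
same calculation shows that a round costs at most a telescoping difference of divergences to the
comparator plus `D(W ‖ N⁻¹) = η ⟨G, W⟩ - log (det N · det W)` (`IsUpdate.bregman_le`).

The second term is small because, after conjugation by a square root of `W`, the matrix `N` becomes
`a I + b x xᵀ` (`exists_whitened`). Its determinant is explicit, and `-log (1 + x) ≤ -x + x²` bounds
the cost by `(d² + 1) (η ℓ)²` (`log_one_round_bound`, `dense_local_bound`).

The draw has second moment `W` and the estimate has mean `L` given the history: the coin side `B =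
1` supplies the diagonal in the eigenbasis, and the random signs supply the off-diagonal entries
through their fourth moments (`sum_denseLaw_smul_denseEstimateCoord`). Hence in expectation the
pathwise bound on estimated losses becomes a bound on true losses (`integral_estimate`). This needs
integrable estimates, hence eigenvalues of `W` bounded away from zero uniformly in `ω`
(`exists_trace_inv_le`).

A rank-one comparator has infinite divergence, so `x xᵀ` is mixed with weight `1/T` with `I/d`; this
costs `2` in total and leaves an initial divergence of at most `d log T`. For `d = 1` the
logarithmic estimate is out of range, but then the regret is zero. -/

namespace BanditPCA

/-! ### Trace inner product and matrices diagonal in a given orthonormal basis. -/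

section Algebra

variable {d : ℕ}

lemma iprod_add_left (A B C : Mat d) : iprod (A + B) C = iprod A C + iprod B C := by
  simp [iprod, Matrix.add_mul]

lemma iprod_sub_left (A B C : Mat d) : iprod (A - B) C = iprod A C - iprod B C := by
  simp [iprod, Matrix.sub_mul]

lemma iprod_smul_left (a : ℝ) (A B : Mat d) : iprod (a • A) B = a * iprod A B := by
  simp [iprod]

lemma iprod_add_right (A B C : Mat d) : iprod A (B + C) = iprod A B + iprod A C := by
  simp [iprod, Matrix.mul_add]

lemma iprod_sub_right (A B C : Mat d) : iprod A (B - C) = iprod A B - iprod A C := by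
  simp [iprod, Matrix.mul_sub]

lemma iprod_smul_right (a : ℝ) (A B : Mat d) : iprod A (a • B) = a * iprod A B := by
  simp [iprod]

lemma iprod_neg_left (A B : Mat d) : iprod (-A) B = -iprod A B := by
  simp [iprod]

lemma iprod_comm (A B : Mat d) : iprod A B = iprod B A := by
  rw [iprod, iprod, ← Matrix.trace_transpose]; simp

lemma iprod_one_left (A : Mat d) : iprod 1 A = A.trace := by simp [iprod]

lemma iprod_one_right (A : Mat d) : iprod A 1 = A.trace := by simp [iprod]

lemma iprod_of_isSymm {A : Mat d} (hA : A.IsSymm) (B : Mat d) : iprod A B = (A * B).trace := by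
  rw [iprod, hA.eq]

lemma iprod_eq_sum (A B : Mat d) : iprod A B = ∑ i, ∑ j, A j i * B j i := by
  simp [iprod, Matrix.trace, Matrix.mul_apply]

lemma iprod_sum_left {ι : Type*} (s : Finset ι) (A : ι → Mat d) (B : Mat d) :
    iprod (∑ i ∈ s, A i) B = ∑ i ∈ s, iprod (A i) B := by
  simp [iprod, Matrix.transpose_sum, Finset.sum_mul, Matrix.trace_sum]

lemma iprod_outer (w : Vec d) (L : Mat d) :
    iprod (outer w) L = w.ofLp ⬝ᵥ L *ᵥ w.ofLp := by
  rw [iprod, outer, Matrix.transpose_vecMulVec, Matrix.vecMulVec_mul, Matrix.trace_vecMulVec,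
    Matrix.dotProduct_mulVec, dotProduct_comm]

lemma isSymm_outer (w : Vec d) : (outer w).IsSymm := by
  rw [outer, Matrix.IsSymm, Matrix.transpose_vecMulVec]

lemma isSymm_ofEigen (c : Fin d → ℝ) (v : Fin d → Vec d) : (ofEigen c v).IsSymm := by
  simp only [ofEigen, Matrix.IsSymm, Matrix.transpose_sum, Matrix.transpose_smul,
    (isSymm_outer _).eq]

lemma invSqrtOfEigen_eq (c : Fin d → ℝ) (v : Fin d → Vec d) :
    invSqrtOfEigen c v = ofEigen (fun i => (Real.sqrt (c i))⁻¹) v := rfl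

lemma isSymm_denseEstimate (c : Fin d → ℝ) (v : Fin d → Vec d) (o : DenseDraw d) (l : ℝ) :
    (denseEstimate c v o l).IsSymm := by
  have h {A B : Mat d} (hA : A.IsSymm) (hB : B.IsSymm) : (A * B * A).IsSymm := by
    simp [Matrix.IsSymm, Matrix.transpose_mul, hA.eq, hB.eq, Matrix.mul_assoc]
  have hinv : (ofEigen c v)⁻¹.IsSymm := by
    rw [Matrix.IsSymm, Matrix.transpose_nonsing_inv, (isSymm_ofEigen c v).eq]
  rcases o with i | s
  · exact (h (by rw [invSqrtOfEigen_eq]; exact isSymm_ofEigen _ _) (isSymm_outer _)).smul _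
  · exact ((h hinv (isSymm_outer _)).sub hinv).smul _

/-- The matrix `V diag(c) Vᵀ`. -/
def conjDiag (V : Mat d) (c : Fin d → ℝ) : Mat d := V * Matrix.diagonal c * Vᵀ

variable {V : Mat d}

lemma conjDiag_mul (hV : Vᵀ * V = 1) (c c' : Fin d → ℝ) :
    conjDiag V c * conjDiag V c' = conjDiag V (fun i => c i * c' i) := by
  calc conjDiag V c * conjDiag V c'
      = V * Matrix.diagonal c * (Vᵀ * V) * Matrix.diagonal c' * Vᵀ := by
        simp only [conjDiag, Matrix.mul_assoc]
    _ = conjDiag V (fun i => c i * c' i) := by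
        rw [hV, Matrix.mul_one, Matrix.mul_assoc V, Matrix.diagonal_mul_diagonal]; rfl

lemma conjDiag_one (hV : Vᵀ * V = 1) : conjDiag V (fun _ => 1) = 1 := by
  rw [conjDiag, Matrix.diagonal_one, Matrix.mul_one, mul_eq_one_comm.mp hV]

lemma conjDiag_add (c c' : Fin d → ℝ) :
    conjDiag V (fun i => c i + c' i) = conjDiag V c + conjDiag V c' := by
  simp only [conjDiag, ← Matrix.diagonal_add, Matrix.mul_add, Matrix.add_mul]

lemma conjDiag_smul (a : ℝ) (c : Fin d → ℝ) :
    conjDiag V (fun i => a * c i) = a • conjDiag V c := by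
  have : Matrix.diagonal (fun i => a * c i) = a • Matrix.diagonal c := by
    rw [← Matrix.diagonal_smul]; rfl
  simp [conjDiag, this]

lemma trace_conjDiag (hV : Vᵀ * V = 1) (c : Fin d → ℝ) : (conjDiag V c).trace = ∑ i, c i := by
  rw [conjDiag, Matrix.trace_mul_comm, ← Matrix.mul_assoc, hV, Matrix.one_mul,
    Matrix.trace_diagonal]

lemma inv_conjDiag (hV : Vᵀ * V = 1) {c : Fin d → ℝ} (hc : ∀ i, c i ≠ 0) :
    (conjDiag V c)⁻¹ = conjDiag V (fun i => (c i)⁻¹) := by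
  apply Matrix.inv_eq_right_inv
  rw [conjDiag_mul hV, ← conjDiag_one hV]
  congr 1; funext i; exact mul_inv_cancel₀ (hc i)

lemma mulVec_injective_of_mul_eq_one {A B : Mat d} (h : B * A = 1) :
    Function.Injective A.mulVec := by
  intro x y hxy
  have := congrArg (B *ᵥ ·) hxy
  simpa [Matrix.mulVec_mulVec, h] using this

lemma posDef_conjDiag (hV : Vᵀ * V = 1) {c : Fin d → ℝ} (hc : ∀ i, 0 < c i) :
    (conjDiag V c).PosDef := by
  have h := (Matrix.posDef_diagonal_iff.mpr hc).conjTranspose_mul_mul_same (B := Vᵀ)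
    (mulVec_injective_of_mul_eq_one (B := V) (mul_eq_one_comm.mp hV))
  simpa [conjDiag] using h

lemma pos_of_posDef_conjDiag (hV : Vᵀ * V = 1) {c : Fin d → ℝ} (h : (conjDiag V c).PosDef) :
    ∀ i, 0 < c i := by
  have h' := h.conjTranspose_mul_mul_same (B := V) (mulVec_injective_of_mul_eq_one hV)
  have e : Vᴴ * conjDiag V c * V = Matrix.diagonal c := by
    calc Vᴴ * conjDiag V c * V = (Vᵀ * V) * Matrix.diagonal c * (Vᵀ * V) := by
          simp only [conjDiag, Matrix.mul_assoc, Matrix.conjTranspose_eq_transpose_of_trivial]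
      _ = _ := by simp [hV]
  rw [e] at h'
  exact Matrix.posDef_diagonal_iff.mp h'

lemma exists_conjDiag_eq {A : Mat d} (hA : A.IsSymm) :
    ∃ (V : Mat d) (c : Fin d → ℝ), Vᵀ * V = 1 ∧ A = conjDiag V c := by
  have hA' : A.IsHermitian := by
    rw [Matrix.IsHermitian, Matrix.conjTranspose_eq_transpose_of_trivial, hA.eq]
  refine ⟨hA'.eigenvectorUnitary, hA'.eigenvalues, ?_, ?_⟩
  · have := Unitary.coe_star_mul_self hA'.eigenvectorUnitary
    simpa [Matrix.star_eq_conjTranspose] using this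
  · conv_lhs => rw [hA'.spectral_theorem]
    simp only [Unitary.conjStarAlgAut_apply, conjDiag, Matrix.star_eq_conjTranspose,
      Matrix.conjTranspose_eq_transpose_of_trivial]
    rfl

end Algebra

/-! ### Existence of the update and its characterization as a mirror descent step. -/

section MirrorDescent

variable {d : ℕ}

/-- A shift by a multiple of the identity makes a symmetric matrix positive definite with an
inverse of trace one. -/
lemma exists_shift (hd : 1 ≤ d) {A : Mat d} (hA : A.IsSymm) :
    ∃ β : ℝ, (A + β • (1 : Mat d)).PosDef ∧ (A + β • (1 : Mat d))⁻¹.trace = 1 := by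
  obtain ⟨V, c, hV, rfl⟩ := exists_conjDiag_eq hA
  have hne : (Finset.univ : Finset (Fin d)).Nonempty := ⟨⟨0, hd⟩, Finset.mem_univ _⟩
  obtain ⟨k, -, hk⟩ := Finset.exists_min_image Finset.univ c hne
  have hd' : (1 : ℝ) ≤ d := by exact_mod_cast hd
  have hpos {β : ℝ} (hβ : 1 - c k ≤ β) (i : Fin d) : 0 < c i + β := by
    have := hk i (Finset.mem_univ _); linarith
  -- With `c k` the least eigenvalue, at `β = 1 - c k` its term alone is `1`, and at `β = d - c k`
  -- every term is at most `1/d`. The intermediate value theorem gives trace one in between.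
  have hcont : ContinuousOn (fun β => ∑ i, (c i + β)⁻¹) (Set.Icc (1 - c k) (d - c k)) := by
    refine continuousOn_finsetSum _ fun i _ => ContinuousOn.inv₀ (by fun_prop) ?_
    intro β hβ
    exact (hpos hβ.1 i).ne'
  have hmem : (1 : ℝ) ∈ Set.Icc (∑ i, (c i + (d - c k))⁻¹) (∑ i, (c i + (1 - c k))⁻¹) := by
    constructor
    · calc ∑ i, (c i + (d - c k))⁻¹ ≤ ∑ _i : Fin d, (d : ℝ)⁻¹ := by
            refine Finset.sum_le_sum fun i _ => ?_
            have := hk i (Finset.mem_univ _)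
            exact inv_anti₀ (by linarith) (by linarith)
        _ = 1 := by simp; field_simp
    · calc (1 : ℝ) = (c k + (1 - c k))⁻¹ := by simp
        _ ≤ ∑ i, (c i + (1 - c k))⁻¹ :=
            Finset.single_le_sum (f := fun i => (c i + (1 - c k))⁻¹)
              (fun i _ => (inv_pos.mpr (hpos le_rfl i)).le) (Finset.mem_univ k)
  obtain ⟨β, hβ, hβ1⟩ := intermediate_value_Icc' (by linarith) hcont hmem
  have e : conjDiag V c + β • (1 : Mat d) = conjDiag V (fun i => c i + β) := by
    rw [conjDiag_add, ← conjDiag_one hV, ← conjDiag_smul]; simp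
  refine ⟨β, ?_, ?_⟩
  · rw [e]; exact posDef_conjDiag hV (hpos hβ.1)
  · rw [e, inv_conjDiag hV fun i => (hpos hβ.1 i).ne', trace_conjDiag hV]; exact hβ1

lemma isSymm_of_posDef {A : Mat d} (hA : A.PosDef) : A.IsSymm := by
  have := hA.isHermitian.eq
  rwa [Matrix.conjTranspose_eq_transpose_of_trivial] at this

lemma inv_mul_of_posDef {A : Mat d} (hA : A.PosDef) : A⁻¹ * A = 1 :=
  Matrix.nonsing_inv_mul _ hA.det_pos.ne'.isUnit

lemma inv_inv_of_posDef {A : Mat d} (hA : A.PosDef) : A⁻¹⁻¹ = A :=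
  Matrix.nonsing_inv_nonsing_inv _ hA.det_pos.ne'.isUnit

lemma isUpdate_update (hd : 1 ≤ d) (η : ℝ) {W G : Mat d} (hW : W.PosDef) (hG : G.IsSymm) :
    IsUpdate η W G (update η W G) := by
  obtain ⟨β, h1, h2⟩ := exists_shift hd ((isSymm_of_posDef hW.inv).add (hG.smul η))
  exact Classical.epsilon_spec (p := IsUpdate η W G) ⟨_, ⟨h1.inv, h2⟩, β, rfl⟩

/-- The shift in an update is the constant by which the inverses differ. -/
lemma IsUpdate.exists_inv_eq {η : ℝ} {W G W' : Mat d} (h : IsUpdate η W G W') :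
    ∃ β : ℝ, W'⁻¹ = W⁻¹ + η • G + β • (1 : Mat d) := by
  obtain ⟨⟨hp, -⟩, β, e⟩ := h
  refine ⟨β, ?_⟩
  -- The inverse of a singular matrix is zero by convention, so positivity of `det W'` rules this
  -- out.
  have hu : IsUnit (W⁻¹ + η • G + β • (1 : Mat d))⁻¹.det := by
    rw [← e]; exact hp.det_pos.ne'.isUnit
  rw [e, Matrix.nonsing_inv_nonsing_inv _ ((Matrix.isUnit_nonsing_inv_det_iff).mp hu)]

lemma log_det_le_trace_sub {A : Mat d} (hA : A.PosDef) : Real.log A.det ≤ A.trace - d := by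
  obtain ⟨V, c, hV, rfl⟩ := exists_conjDiag_eq (isSymm_of_posDef hA)
  have hc := pos_of_posDef_conjDiag hV hA
  have hdet : (conjDiag V c).det = ∏ i, c i := by
    rw [conjDiag, Matrix.det_mul, Matrix.det_mul, Matrix.det_diagonal, mul_right_comm,
      mul_comm V.det, ← Matrix.det_mul, hV, Matrix.det_one, one_mul]
  rw [hdet, trace_conjDiag hV, Real.log_prod fun i _ => (hc i).ne']
  calc ∑ i, Real.log (c i) ≤ ∑ i, (c i - 1) :=
        Finset.sum_le_sum fun i _ => Real.log_le_sub_one_of_pos (hc i)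
    _ = _ := by simp

lemma exists_sq_eq_of_posDef {A : Mat d} (hA : A.PosDef) :
    ∃ Q : Mat d, Q.IsSymm ∧ Q * Q = A ∧ IsUnit Q.det := by
  obtain ⟨V, c, hV, rfl⟩ := exists_conjDiag_eq (isSymm_of_posDef hA)
  have hc := pos_of_posDef_conjDiag hV hA
  have hsq : conjDiag V (fun i => Real.sqrt (c i)) * conjDiag V (fun i => Real.sqrt (c i))
      = conjDiag V c := by
    rw [conjDiag_mul hV]; congr 1; funext i; exact Real.mul_self_sqrt (hc i).le
  refine ⟨_, ?_, hsq, ?_⟩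
  · exact isSymm_of_posDef (posDef_conjDiag hV fun i => Real.sqrt_pos.mpr (hc i))
  · exact (posDef_conjDiag hV fun i => Real.sqrt_pos.mpr (hc i)).det_pos.ne'.isUnit

lemma bregman_eq {V U : Mat d} (hU : U.PosDef) :
    bregman V U = Real.log U.det - Real.log V.det + iprod U⁻¹ V - d := by
  have h : iprod U⁻¹ U = d := by
    rw [iprod_of_isSymm (isSymm_of_posDef hU.inv), inv_mul_of_posDef hU]; simp
  simp only [bregman, negLogDet, iprod_neg_left, iprod_sub_right, h]; ring

/-- With `Q = U^(-1/2)`, the divergence is `tr C - d - log det C` for `C = Q V Q`, and `log c ≤ c -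
1` applies to each eigenvalue of `C`. -/
lemma bregman_nonneg {V U : Mat d} (hV : V.PosDef) (hU : U.PosDef) : 0 ≤ bregman V U := by
  obtain ⟨Q, hQs, hQ, hQu⟩ := exists_sq_eq_of_posDef hU.inv
  have hC : (Q * V * Q).PosDef := by
    have := hV.conjTranspose_mul_mul_same (B := Q)
      (mulVec_injective_of_mul_eq_one (Matrix.nonsing_inv_mul Q hQu))
    rwa [Matrix.conjTranspose_eq_transpose_of_trivial, hQs.eq] at this
  have h := log_det_le_trace_sub hC
  have ht : (Q * V * Q).trace = iprod U⁻¹ V := by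
    rw [iprod_of_isSymm (isSymm_of_posDef hU.inv), ← hQ, Matrix.trace_mul_comm, Matrix.mul_assoc]
  have hdet : (Q * V * Q).det = V.det * U.det⁻¹ := by
    have : (Q * Q).det = U.det⁻¹ := by rw [hQ, Matrix.det_nonsing_inv, Ring.inverse_eq_inv']
    rw [Matrix.det_mul, Matrix.det_mul, ← this, Matrix.det_mul]; ring
  rw [ht, hdet, Real.log_mul hV.det_pos.ne' (inv_ne_zero hU.det_pos.ne'), Real.log_inv] at h
  rw [bregman_eq hU]; linarith

/-- Since `W⁻¹ + η G = W'⁻¹ - β I` and `tr V = 1`, the objective at `V` equals `bregman V W'` plus a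
constant independent of `V`. Nonnegativity of the divergence then gives minimality at `W'`. -/
lemma IsUpdate.isMirrorDescentStep {η : ℝ} {W G W' : Mat d} (hW : W.PosDef)
    (h : IsUpdate η W G W') : IsMirrorDescentStep η W G W' := by
  obtain ⟨β, hβ⟩ := h.exists_inv_eq
  refine ⟨h.1, fun V hV => ?_⟩
  have hb := bregman_nonneg hV.1 h.1.1
  have hone : iprod W'⁻¹ W' = d := by
    rw [iprod_of_isSymm (isSymm_of_posDef h.1.1.inv), inv_mul_of_posDef h.1.1]; simp
  rw [bregman_eq h.1.1] at hb
  simp only [Set.mem_ofPred_eq]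
  rw [bregman_eq hW, bregman_eq hW]
  rw [hβ, iprod_add_left, iprod_add_left, iprod_smul_left, iprod_smul_left, iprod_one_left]
    at hone hb
  rw [hV.2] at hb
  rw [h.1.2] at hone
  rw [iprod_comm V, iprod_comm W']
  linarith

end MirrorDescent

/-! ### One-round inequalities for the update. -/

section Update

variable {d : ℕ}

lemma iprod_nonneg_of_posDef {A B : Mat d} (hA : A.PosDef) (hB : B.PosDef) : 0 ≤ iprod A B := by
  obtain ⟨Q, hQs, hQ, -⟩ := exists_sq_eq_of_posDef hA
  have h := (hB.posSemidef.conjTranspose_mul_mul_same Q).trace_nonneg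
  rw [Matrix.conjTranspose_eq_transpose_of_trivial, hQs.eq] at h
  rwa [iprod_of_isSymm (isSymm_of_posDef hA), ← hQ, Matrix.mul_assoc, Matrix.trace_mul_comm]

/-- The one-round inequality of mirror descent with the regularizer `- log det`. -/
lemma IsUpdate.bregman_le {η : ℝ} {W G W' U : Mat d} (hW : W.PosDef) (h : IsUpdate η W G W')
    (hN : (W⁻¹ + η • G).PosDef) (hU : U ∈ posDensity d) :
    η * iprod G (W - U) ≤ bregman U W - bregman U W'
      + (η * iprod G W - Real.log ((W⁻¹ + η • G).det * W.det)) := by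
  obtain ⟨β, hβ⟩ := h.exists_inv_eq
  have hone : iprod W'⁻¹ W' = d := by
    rw [iprod_of_isSymm (isSymm_of_posDef h.1.1.inv), inv_mul_of_posDef h.1.1]; simp
  -- The two sides of the claim differ exactly by `D(W' ‖ N⁻¹)`, where `N = W⁻¹ + η G`.
  have hb := bregman_nonneg h.1.1 hN.inv
  rw [bregman_eq hN.inv, inv_inv_of_posDef hN, Matrix.det_nonsing_inv, Ring.inverse_eq_inv',
    Real.log_inv] at hb
  rw [hβ, iprod_add_left, iprod_smul_left, iprod_one_left, h.1.2] at hone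
  rw [bregman_eq hW, bregman_eq h.1.1, hβ, iprod_add_left (W⁻¹ + η • G), iprod_add_left W⁻¹,
    iprod_smul_left, iprod_smul_left, iprod_one_left, hU.2, iprod_sub_right,
    Real.log_mul hN.det_pos.ne' hW.det_pos.ne']
  linarith

/-- Pairing `W'⁻¹ = N + β I` with `W'` gives `d = ⟨N, W'⟩ + β ≥ β`, so the shift adds at most `d ·
d` to the trace. This is the recursion that keeps the eigenvalues of the iterates away from zero. -/
lemma IsUpdate.trace_inv_le {η : ℝ} {W G W' : Mat d} (h : IsUpdate η W G W')
    (hN : (W⁻¹ + η • G).PosDef) :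
    W'⁻¹.trace ≤ W⁻¹.trace + η * G.trace + (d : ℝ) ^ 2 := by
  obtain ⟨β, hβ⟩ := h.exists_inv_eq
  have hone : iprod W'⁻¹ W' = d := by
    rw [iprod_of_isSymm (isSymm_of_posDef h.1.1.inv), inv_mul_of_posDef h.1.1]; simp
  have hn := iprod_nonneg_of_posDef hN h.1.1
  rw [hβ, iprod_add_left, iprod_smul_left, iprod_one_left, h.1.2] at hone
  have hβd : β * d ≤ d * d := by
    apply mul_le_mul_of_nonneg_right _ (Nat.cast_nonneg d); linarith
  rw [hβ]
  simp only [Matrix.trace_add, Matrix.trace_smul, Matrix.trace_one, smul_eq_mul, Fintype.card_fin]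
  linarith

end Update

/-! ### Rank-one perturbations of multiples of the identity, and a quadratic bound for the
logarithm. -/

section RankOne

variable {d : ℕ}

lemma posDef_smul_one_add_vecMulVec {a b : ℝ} {x : Fin d → ℝ} (ha : 0 < a)
    (hab : 0 < a + b * (x ⬝ᵥ x)) : (a • (1 : Mat d) + b • Matrix.vecMulVec x x).PosDef := by
  apply Matrix.PosDef.of_dotProduct_mulVec_pos
  · rw [Matrix.IsHermitian, Matrix.conjTranspose_eq_transpose_of_trivial]
    simp [Matrix.transpose_vecMulVec]
  · intro z hz
    have e : star z ⬝ᵥ (a • (1 : Mat d) + b • Matrix.vecMulVec x x) *ᵥ z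
        = a * (z ⬝ᵥ z) + b * (x ⬝ᵥ z) ^ 2 := by
      simp only [star_trivial, Matrix.add_mulVec, Matrix.smul_mulVec, Matrix.one_mulVec,
        Matrix.vecMulVec_mulVec, dotProduct_add, dotProduct_smul, smul_eq_mul,
        op_smul_eq_smul, dotProduct_comm z x]
      ring
    rw [e]
    have hz0 : 0 < z ⬝ᵥ z := by
      have := Matrix.dotProduct_star_self_pos_iff.mpr hz
      simpa using this
    -- Cauchy–Schwarz is what controls the case `b ≤ 0`.
    have hcs : (x ⬝ᵥ z) ^ 2 ≤ (x ⬝ᵥ x) * (z ⬝ᵥ z) := by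
      have := Finset.sum_mul_sq_le_sq_mul_sq Finset.univ x z
      simpa [dotProduct, sq] using this
    rcases le_total 0 b with hb | hb
    · have := mul_nonneg hb (sq_nonneg (x ⬝ᵥ z))
      have := mul_pos ha hz0
      linarith
    · have := mul_le_mul_of_nonpos_left hcs hb
      have := mul_pos hab hz0
      nlinarith

lemma det_smul_one_add_vecMulVec (hd : 1 ≤ d) {a b : ℝ} {x : Fin d → ℝ} (ha : a ≠ 0) :
    (a • (1 : Mat d) + b • Matrix.vecMulVec x x).det = a ^ (d - 1) * (a + b * (x ⬝ᵥ x)) := by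
  have e : a • (1 : Mat d) + b • Matrix.vecMulVec x x
      = a • (1 + Matrix.replicateCol Unit ((b / a) • x) * Matrix.replicateRow Unit x) := by
    rw [← Matrix.vecMulVec_eq, smul_add, Matrix.smul_vecMulVec, smul_smul, mul_div_cancel₀ _ ha]
  rw [e, Matrix.det_smul, Matrix.det_one_add_replicateCol_mul_replicateRow, Fintype.card_fin]
  obtain ⟨n, rfl⟩ : ∃ n, d = n + 1 := ⟨d - 1, by omega⟩
  rw [dotProduct_smul, smul_eq_mul, Nat.add_sub_cancel, pow_succ]
  field_simp

lemma neg_log_one_add_le {x : ℝ} (hx : |x| ≤ 1 / 2) : -Real.log (1 + x) ≤ -x + x ^ 2 := by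
  obtain ⟨h1, h2⟩ := abs_le.mp hx
  have hpos : 0 < 1 + x := by linarith
  rcases le_total 0 x with h0 | h0
  · have h := Real.one_sub_inv_le_log_of_pos hpos
    have : x - x ^ 2 ≤ 1 - (1 + x)⁻¹ := by
      have e : 1 - (1 + x)⁻¹ = x / (1 + x) := by field_simp; ring
      rw [e, le_div_iff₀ hpos]
      nlinarith [pow_nonneg h0 3]
    linarith
  · obtain ⟨y, rfl⟩ : ∃ y, x = -y := ⟨-x, by ring⟩
    have hy : 0 ≤ y := by linarith
    have hq := Real.quadratic_le_exp_of_nonneg (x := y + y ^ 2) (by positivity)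
    have hone : 1 ≤ (1 + -y) * Real.exp (y + y ^ 2) := by
      refine le_trans ?_ (mul_le_mul_of_nonneg_left hq hpos.le)
      -- The product `(1 - y)(1 + z + z²/2)` with `z = y + y²` equals `1 + (y²/2)(1 - y - y² - y³)`.
      have h3 : y + y ^ 2 + y ^ 3 ≤ 1 := by nlinarith [pow_nonneg hy 2]
      nlinarith [mul_nonneg (sq_nonneg y) (sub_nonneg.mpr h3)]
    have := Real.log_nonneg hone
    rw [Real.log_mul hpos.ne' (Real.exp_pos _).ne', Real.log_exp] at this
    linarith

end RankOne

/-! ### Dense sampling in eigenvector coordinates. -/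

section Frame

variable {d : ℕ}

/-- The matrix with columns `v i`. -/
def frame (v : Fin d → Vec d) : Mat d := Matrix.of fun j i => v i j

/-- The coordinates, in the basis `v`, of the vector played by dense sampling. -/
noncomputable def denseCoord (lam : Fin d → ℝ) : DenseDraw d → Fin d → ℝ
  | Sum.inl i => Pi.single i 1
  | Sum.inr s => fun i => ((s i : ℤ) : ℝ) * Real.sqrt (lam i)

/-- The dense sampling estimate, written in the basis `v`. -/
noncomputable def denseEstimateCoord (lam : Fin d → ℝ) (o : DenseDraw d) (l : ℝ) : Mat d :=
  let r : Fin d → ℝ := fun i => (Real.sqrt (lam i))⁻¹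
  match o with
  | Sum.inl i => (2 * l) • Matrix.vecMulVec (Pi.single i (r i)) (Pi.single i (r i))
  | Sum.inr s =>
      l • (Matrix.vecMulVec (fun i => ((s i : ℤ) : ℝ) * r i) (fun i => ((s i : ℤ) : ℝ) * r i)
        - Matrix.diagonal fun i => (lam i)⁻¹)

variable {v : Fin d → Vec d} {lam : Fin d → ℝ}

lemma frame_transpose_mul (hv : Orthonormal ℝ v) : (frame v)ᵀ * frame v = 1 := by
  ext i j
  have := orthonormal_iff_ite.mp hv i j
  rw [Matrix.mul_apply, Matrix.one_apply, ← this]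
  simp [frame, PiLp.inner_apply, mul_comm]

lemma outer_eq_of_ofLp_eq {w : Vec d} {x : Fin d → ℝ} (h : w.ofLp = frame v *ᵥ x) :
    outer w = frame v * Matrix.vecMulVec x x * (frame v)ᵀ := by
  rw [outer, h, Matrix.mul_vecMulVec, Matrix.vecMulVec_mul, Matrix.vecMul_transpose]

lemma ofLp_eq_frame_mulVec (i : Fin d) : (v i).ofLp = frame v *ᵥ Pi.single i 1 := by
  ext j; simp [frame]

lemma ofLp_sum_smul (x : Fin d → ℝ) : (∑ i, x i • v i).ofLp = frame v *ᵥ x := by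
  ext j
  simp [frame, Matrix.mulVec, dotProduct, mul_comm]

lemma ofEigen_eq_conjDiag (c : Fin d → ℝ) : ofEigen c v = conjDiag (frame v) c := by
  have : Matrix.diagonal c = ∑ i, c i • Matrix.vecMulVec (Pi.single i (1 : ℝ)) (Pi.single i 1) := by
    ext j k
    simp only [Matrix.sum_apply, Matrix.smul_apply, Matrix.vecMulVec_apply, Pi.single_apply,
      Matrix.diagonal_apply, smul_eq_mul]
    by_cases h : j = k
    · subst h; simp
    · rw [if_neg h, Finset.sum_eq_zero]
      intro i _
      by_cases hj : j = i
      · simp [show k ≠ i from fun e => h (hj.trans e.symm)]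
      · simp [hj]
  rw [conjDiag, this, ofEigen, Finset.mul_sum, Finset.sum_mul]
  refine Finset.sum_congr rfl fun i _ => ?_
  rw [outer_eq_of_ofLp_eq (ofLp_eq_frame_mulVec i), Matrix.mul_smul, Matrix.smul_mul]

lemma ofLp_denseVector (o : DenseDraw d) :
    (denseVector lam v o).ofLp = frame v *ᵥ denseCoord lam o := by
  rcases o with i | s
  · exact ofLp_eq_frame_mulVec i
  · exact ofLp_sum_smul _

lemma outer_denseVector (o : DenseDraw d) : outer (denseVector lam v o)
    = frame v * Matrix.vecMulVec (denseCoord lam o) (denseCoord lam o) * (frame v)ᵀ :=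
  outer_eq_of_ofLp_eq (ofLp_denseVector o)

lemma conjDiag_mul_conj_mul {V : Mat d} (hV : Vᵀ * V = 1) (c x : Fin d → ℝ) :
    conjDiag V c * (V * Matrix.vecMulVec x x * Vᵀ) * conjDiag V c
      = V * Matrix.vecMulVec (fun i => c i * x i) (fun i => c i * x i) * Vᵀ := by
  have h1 : (fun i => c i * x i) = Matrix.diagonal c *ᵥ x := by
    ext i; rw [Matrix.mulVec_diagonal]
  have h2 : Matrix.diagonal c *ᵥ x = x ᵥ* Matrix.diagonal c := by
    ext i; rw [Matrix.mulVec_diagonal, Matrix.vecMul_diagonal, mul_comm]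
  have h3 : Matrix.vecMulVec (fun i => c i * x i) (fun i => c i * x i)
      = Matrix.diagonal c * Matrix.vecMulVec x x * Matrix.diagonal c := by
    rw [Matrix.mul_vecMulVec, Matrix.vecMulVec_mul, ← h2, h1]
  rw [h3]
  calc conjDiag V c * (V * Matrix.vecMulVec x x * Vᵀ) * conjDiag V c
      = V * Matrix.diagonal c * (Vᵀ * V) * Matrix.vecMulVec x x * (Vᵀ * V)
          * Matrix.diagonal c * Vᵀ := by simp only [conjDiag, Matrix.mul_assoc]
    _ = _ := by rw [hV]; simp only [Matrix.mul_one, Matrix.mul_assoc]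

lemma denseEstimate_eq (hv : Orthonormal ℝ v) (hlam : ∀ i, 0 < lam i) (o : DenseDraw d) (l : ℝ) :
    denseEstimate lam v o l = frame v * denseEstimateCoord lam o l * (frame v)ᵀ := by
  have hV := frame_transpose_mul hv
  rcases o with i | s
  · simp only [denseEstimate, denseEstimateCoord]
    rw [outer_denseVector, invSqrtOfEigen_eq, ofEigen_eq_conjDiag, conjDiag_mul_conj_mul hV,
      Matrix.mul_smul, Matrix.smul_mul]
    have : (fun j => (Real.sqrt (lam j))⁻¹ * denseCoord lam (Sum.inl i) j)
        = Pi.single i (Real.sqrt (lam i))⁻¹ := by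
      ext j
      by_cases h : j = i
      · subst h; simp [denseCoord]
      · simp [denseCoord, h]
    rw [this]
  · simp only [denseEstimate, denseEstimateCoord]
    rw [outer_denseVector, ofEigen_eq_conjDiag, inv_conjDiag hV fun i => (hlam i).ne',
      conjDiag_mul_conj_mul hV, Matrix.mul_smul, Matrix.smul_mul, Matrix.mul_sub, Matrix.sub_mul]
    have : (fun j => (lam j)⁻¹ * denseCoord lam (Sum.inr s) j)
        = fun j => ((s j : ℤ) : ℝ) * (Real.sqrt (lam j))⁻¹ := by
      ext j
      have h1 := Real.sqrt_pos.mpr (hlam j)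
      have h2 : lam j = Real.sqrt (lam j) * Real.sqrt (lam j) :=
        (Real.mul_self_sqrt (hlam j).le).symm
      simp only [denseCoord]
      nth_rewrite 1 [h2]
      field_simp
    rw [this]; rfl

end Frame

/-! ### The cost of one round. -/

section OneRound

variable {d : ℕ} {v : Fin d → Vec d} {lam : Fin d → ℝ}

lemma units_cast_mul_self (u : ℤˣ) : ((u : ℤ) : ℝ) * ((u : ℤ) : ℝ) = 1 := by
  rcases Int.units_eq_one_or u with h | h <;> simp [h]

/-- In whitened coordinates an update direction of dense sampling is a rank-one perturbation
of the identity. -/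
lemma exists_whitened (hlam : ∀ i, 0 < lam i) (o : DenseDraw d) (l η : ℝ) :
    let S : Mat d := Matrix.diagonal fun i => Real.sqrt (lam i)
    ∃ (a b : ℝ) (x : Fin d → ℝ),
      1 + η • (S * denseEstimateCoord lam o l * S) = a • (1 : Mat d) + b • Matrix.vecMulVec x x ∧
      ((a = 1 ∧ b = 2 * (η * l) ∧ x ⬝ᵥ x = 1) ∨ (a = 1 - η * l ∧ b = η * l ∧ x ⬝ᵥ x = d)) := by
  intro S
  have hs (i : Fin d) : Real.sqrt (lam i) ≠ 0 := (Real.sqrt_pos.mpr (hlam i)).ne'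
  have hconj (y : Fin d → ℝ) : S * Matrix.vecMulVec y y * S
      = Matrix.vecMulVec (fun i => Real.sqrt (lam i) * y i) (fun i => Real.sqrt (lam i) * y i) := by
    have h1 : (fun i => Real.sqrt (lam i) * y i) = S *ᵥ y := by
      ext i; rw [Matrix.mulVec_diagonal]
    have h2 : S *ᵥ y = y ᵥ* S := by
      ext i; rw [Matrix.mulVec_diagonal, Matrix.vecMul_diagonal, mul_comm]
    rw [Matrix.mul_vecMulVec, Matrix.vecMulVec_mul, ← h2, h1]
  rcases o with i | s
  · refine ⟨1, 2 * (η * l), Pi.single i 1, ?_, Or.inl ⟨rfl, rfl, by simp⟩⟩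
    simp only [denseEstimateCoord, Matrix.mul_smul, Matrix.smul_mul, hconj]
    have : (fun j => Real.sqrt (lam j)
        * (Pi.single i (Real.sqrt (lam i))⁻¹ : Fin d → ℝ) j) = Pi.single i 1 := by
      ext j
      by_cases h : j = i
      · subst h; simp [hs j]
      · simp [h]
    rw [this, one_smul, smul_smul]
    congr 2; ring
  · refine ⟨1 - η * l, η * l, fun i => ((s i : ℤ) : ℝ), ?_, Or.inr ⟨rfl, rfl, ?_⟩⟩
    · simp only [denseEstimateCoord, Matrix.mul_smul, Matrix.smul_mul, Matrix.mul_sub,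
        Matrix.sub_mul, hconj]
      have h1 : (fun j => Real.sqrt (lam j) * (((s j : ℤ) : ℝ) * (Real.sqrt (lam j))⁻¹))
          = fun j => ((s j : ℤ) : ℝ) := by
        ext j; have := hs j; field_simp
      have h2 : S * (Matrix.diagonal fun i => (lam i)⁻¹) * S = 1 := by
        rw [Matrix.diagonal_mul_diagonal, Matrix.diagonal_mul_diagonal, ← Matrix.diagonal_one]
        congr 1; ext j
        have := hs j
        nth_rewrite 2 [← Real.mul_self_sqrt (hlam j).le]
        field_simp
      rw [h1, h2, smul_smul, smul_sub, sub_smul, one_smul]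
      abel
    · simp [dotProduct, units_cast_mul_self]

/-- Here `y = η l`, and `a`, `b`, `q = x ⬝ᵥ x` come from `exists_whitened`. For `B = 1` the
quadratic bound gives `4 y²`, at most `d² y²` because `d ≥ 2`. For `B = 0` the linear terms of `(d -
1) log (1 - y)` and `log (1 + (d - 1) y)` cancel, leaving `d (d - 1) y²`. -/
lemma log_one_round_bound {d : ℕ} (hd : 2 ≤ d) {a b q y : ℝ} (hy : |y| ≤ 1 / (2 * (d : ℝ)))
    (h : (a = 1 ∧ b = 2 * y ∧ q = 1) ∨ (a = 1 - y ∧ b = y ∧ q = d)) :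
    0 < a ∧ 0 < a + b * q ∧
      (d * a + b * q - d) - Real.log (a ^ (d - 1) * (a + b * q)) ≤ ((d : ℝ) ^ 2 + 1) * y ^ 2 := by
  have hd' : (2 : ℝ) ≤ d := by exact_mod_cast hd
  have hyd : |y| * d ≤ 1 / 2 := by
    rw [le_div_iff₀ (by positivity)] at hy; linarith
  rcases h with ⟨rfl, rfl, rfl⟩ | ⟨rfl, hb, rfl⟩
  · have h2y : |2 * y| ≤ 1 / 2 := by
      rw [abs_mul, abs_two]; nlinarith [abs_nonneg y]
    have hlog := neg_log_one_add_le h2y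
    have := abs_le.mp h2y
    refine ⟨one_pos, by linarith, ?_⟩
    simp only [one_pow, one_mul, mul_one]
    have h4 : 4 ≤ (d : ℝ) ^ 2 := by nlinarith
    nlinarith [sq_nonneg y, mul_le_mul_of_nonneg_right h4 (sq_nonneg y)]
  · rw [hb]
    have hy1 : |-y| ≤ 1 / 2 := by rw [abs_neg]; nlinarith [abs_nonneg y]
    have hy2 : |y * (d - 1)| ≤ 1 / 2 := by
      rw [abs_mul, abs_of_nonneg (by linarith : (0 : ℝ) ≤ d - 1)]; nlinarith [abs_nonneg y]
    have hlog1 := neg_log_one_add_le hy1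
    have hlog2 := neg_log_one_add_le hy2
    have b1 := abs_le.mp hy1
    have b2 := abs_le.mp hy2
    have p1 : 0 < 1 - y := by linarith
    have p2 : 0 < 1 - y + y * d := by linarith
    refine ⟨p1, p2, ?_⟩
    rw [Real.log_mul (pow_pos p1 _).ne' p2.ne', Real.log_pow, Nat.cast_sub (by omega),
      Nat.cast_one]
    have e1 : 1 + -y = 1 - y := by ring
    have e2 : 1 + y * ((d : ℝ) - 1) = 1 - y + y * d := by ring
    rw [e1] at hlog1
    rw [e2] at hlog2
    have := mul_le_mul_of_nonneg_left hlog1 (by linarith : (0 : ℝ) ≤ d - 1)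
    nlinarith [sq_nonneg y, mul_nonneg (sq_nonneg y) (by linarith : (0 : ℝ) ≤ d)]

/-- For a small learning rate the unnormalized update of dense sampling is positive definite,
and the local norm term of the analysis is at most `(d² + 1) (η l)²`. -/
lemma dense_local_bound (hd : 2 ≤ d) (hv : Orthonormal ℝ v) (hlam : ∀ i, 0 < lam i) {η l : ℝ}
    (hη : 0 < η) (hηd : η ≤ 1 / (2 * (d : ℝ))) (hl : |l| ≤ 1) (o : DenseDraw d) :
    ((ofEigen lam v)⁻¹ + η • denseEstimate lam v o l).PosDef ∧
      η * iprod (denseEstimate lam v o l) (ofEigen lam v)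
        - Real.log (((ofEigen lam v)⁻¹ + η • denseEstimate lam v o l).det * (ofEigen lam v).det)
      ≤ η ^ 2 * ((d : ℝ) ^ 2 + 1) * l ^ 2 := by
  have hV := frame_transpose_mul hv
  set V := frame v
  set S : Mat d := Matrix.diagonal fun i => Real.sqrt (lam i) with hS
  set W := ofEigen lam v with hW
  set G := denseEstimate lam v o l with hG
  have hs (i : Fin d) : Real.sqrt (lam i) ≠ 0 := (Real.sqrt_pos.mpr (hlam i)).ne'
  have hST : Sᵀ = S := Matrix.diagonal_transpose _
  have hSS : S * S = Matrix.diagonal lam := by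
    rw [hS, Matrix.diagonal_mul_diagonal]; congr 1; ext i; exact Real.mul_self_sqrt (hlam i).le
  -- The matrix `V S` serves as a square root of `W`: conjugation by it turns `W⁻¹` into the
  -- identity, and determinants and traces transfer.
  have hWe : W = (V * S) * (V * S)ᵀ := by
    rw [hW, ofEigen_eq_conjDiag, conjDiag, ← hSS, Matrix.transpose_mul, hST]
    simp only [Matrix.mul_assoc]; rfl
  have hWp : W.PosDef := by rw [hW, ofEigen_eq_conjDiag]; exact posDef_conjDiag hV hlam
  have hdetQ : IsUnit (V * S).det := by
    have := hWp.det_pos.ne'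
    rw [hWe, Matrix.det_mul] at this
    exact (left_ne_zero_of_mul this).isUnit
  have hQW : (V * S)ᵀ * W⁻¹ * (V * S) = 1 := by
    have hT : IsUnit ((V * S)ᵀ).det := by rwa [Matrix.det_transpose]
    rw [hWe, Matrix.mul_inv_rev, Matrix.mul_assoc, Matrix.mul_assoc, Matrix.nonsing_inv_mul _ hdetQ,
      Matrix.mul_one, Matrix.mul_nonsing_inv _ hT]
  have hQG : (V * S)ᵀ * G * (V * S) = S * denseEstimateCoord lam o l * S := by
    rw [hG, denseEstimate_eq hv hlam, Matrix.transpose_mul, hST]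
    calc S * Vᵀ * (V * denseEstimateCoord lam o l * Vᵀ) * (V * S)
        = S * (Vᵀ * V) * denseEstimateCoord lam o l * (Vᵀ * V) * S := by
          simp only [Matrix.mul_assoc]
      _ = _ := by rw [hV]; simp only [Matrix.mul_one]
  obtain ⟨a, b, x, hx, hcase⟩ := exists_whitened hlam o l η
  have hy : |η * l| ≤ 1 / (2 * (d : ℝ)) := by
    rw [abs_mul, abs_of_pos hη]; nlinarith [abs_nonneg l]
  obtain ⟨ha, hab, hbound⟩ := log_one_round_bound hd hy hcase
  have hN : (V * S)ᵀ * (W⁻¹ + η • G) * (V * S) = a • (1 : Mat d) + b • Matrix.vecMulVec x x := by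
    rw [Matrix.mul_add, Matrix.add_mul, hQW, Matrix.mul_smul, Matrix.smul_mul, hQG, hx]
  have hp := posDef_smul_one_add_vecMulVec ha hab
  refine ⟨?_, ?_⟩
  · have := hp.conjTranspose_mul_mul_same (B := (V * S)⁻¹)
      (mulVec_injective_of_mul_eq_one (Matrix.mul_nonsing_inv (V * S) hdetQ))
    rw [← hN, Matrix.conjTranspose_eq_transpose_of_trivial] at this
    have e : ((V * S)⁻¹)ᵀ * ((V * S)ᵀ * (W⁻¹ + η • G) * (V * S)) * (V * S)⁻¹ = W⁻¹ + η • G := by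
      have h1 : ((V * S)⁻¹)ᵀ * (V * S)ᵀ = 1 := by
        rw [← Matrix.transpose_mul, Matrix.mul_nonsing_inv _ hdetQ, Matrix.transpose_one]
      calc _ = (((V * S)⁻¹)ᵀ * (V * S)ᵀ) * (W⁻¹ + η • G) * ((V * S) * (V * S)⁻¹) := by
            simp only [Matrix.mul_assoc]
        _ = _ := by rw [h1, Matrix.mul_nonsing_inv _ hdetQ, Matrix.one_mul, Matrix.mul_one]
    rwa [e] at this
  · have hdet : (W⁻¹ + η • G).det * W.det = a ^ (d - 1) * (a + b * (x ⬝ᵥ x)) := by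
      rw [← det_smul_one_add_vecMulVec (by omega) ha.ne', ← hN, hWe]
      simp only [Matrix.det_mul]; ring
    have htr : η * iprod G W = d * a + b * (x ⬝ᵥ x) - d := by
      have h1 := congrArg Matrix.trace hx
      rw [← hS, ← hQG] at h1
      simp only [Matrix.trace_add, Matrix.trace_smul, Matrix.trace_one, Fintype.card_fin,
        Matrix.trace_vecMulVec, smul_eq_mul] at h1
      have h2 : iprod G W = ((V * S)ᵀ * G * (V * S)).trace := by
        rw [iprod_of_isSymm (isSymm_denseEstimate _ _ _ _), hWe, ← Matrix.mul_assoc,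
          Matrix.trace_mul_comm, Matrix.mul_assoc]
      rw [h2]; linarith
    rw [hdet, htr]
    calc _ ≤ ((d : ℝ) ^ 2 + 1) * (η * l) ^ 2 := hbound
      _ = _ := by ring

/-- For `B = 0` the diagonal of the estimate vanishes in the eigenbasis because `s i ² = 1`; for `B
= 1` the trace is `2 l / lam i`. -/
lemma trace_denseEstimate_le (hv : Orthonormal ℝ v) (hlam : ∀ i, 0 < lam i) {l : ℝ}
    (hl : |l| ≤ 1) (o : DenseDraw d) :
    (denseEstimate lam v o l).trace ≤ 2 * (ofEigen lam v)⁻¹.trace := by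
  have hV := frame_transpose_mul hv
  have hpos : ∀ i ∈ Finset.univ, 0 ≤ (lam i)⁻¹ := fun i _ => (inv_pos.mpr (hlam i)).le
  rw [denseEstimate_eq hv hlam, Matrix.trace_mul_comm, ← Matrix.mul_assoc, hV, Matrix.one_mul,
    ofEigen_eq_conjDiag, inv_conjDiag hV fun i => (hlam i).ne', trace_conjDiag hV]
  have hinv (i : Fin d) : (Real.sqrt (lam i))⁻¹ * (Real.sqrt (lam i))⁻¹ = (lam i)⁻¹ := by
    rw [← mul_inv, Real.mul_self_sqrt (hlam i).le]
  rcases o with i | s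
  · simp only [denseEstimateCoord, Matrix.trace_smul, Matrix.trace_vecMulVec, single_dotProduct,
      Pi.single_eq_same, smul_eq_mul, hinv]
    have h1 := Finset.single_le_sum hpos (Finset.mem_univ i)
    have h2 := hpos i (Finset.mem_univ i)
    nlinarith [(abs_le.mp hl).2]
  · simp only [denseEstimateCoord, Matrix.trace_smul, Matrix.trace_sub, Matrix.trace_vecMulVec,
      Matrix.trace_diagonal, smul_eq_mul, dotProduct]
    have : ∑ i, ((s i : ℤ) : ℝ) * (Real.sqrt (lam i))⁻¹ * (((s i : ℤ) : ℝ) * (Real.sqrt (lam i))⁻¹)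
        = ∑ i, (lam i)⁻¹ := by
      refine Finset.sum_congr rfl fun i _ => ?_
      rw [mul_mul_mul_comm, units_cast_mul_self, hinv, one_mul]
    rw [this, sub_self, mul_zero]
    exact mul_nonneg zero_le_two (Finset.sum_nonneg hpos)

end OneRound

/-! ### Sign moments and unbiasedness. -/

section Moments

variable {d : ℕ}

/-- The expectation of `f` under uniform signs. -/
noncomputable def signMean (f : (Fin d → ℤˣ) → ℝ) : ℝ := ∑ s, (1 / 2 : ℝ) ^ d * f s

lemma signMean_const (c : ℝ) : signMean (fun _ : Fin d → ℤˣ => c) = c := by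
  simp [signMean, Fintype.card_units_int]

/-- Flipping the `k`-th sign permutes the sign vectors and preserves the uniform law. -/
lemma signMean_eq_zero_of_odd {f : (Fin d → ℤˣ) → ℝ} (k : Fin d)
    (hf : ∀ s, f (s * Pi.mulSingle k (-1)) = -f s) : signMean f = 0 := by
  have h : signMean f = signMean fun s => f (s * Pi.mulSingle k (-1)) := by
    rw [signMean, signMean, ← Equiv.sum_comp (Equiv.mulRight (Pi.mulSingle k (-1)))]
    rfl
  have h2 : signMean f = -signMean f := by
    nth_rewrite 1 [h]
    simp only [hf, signMean, mul_neg, Finset.sum_neg_distrib]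
  linarith

lemma signMean_mul_left (c : ℝ) (f : (Fin d → ℤˣ) → ℝ) :
    signMean (fun s => c * f s) = c * signMean f := by
  simp only [signMean, Finset.mul_sum]
  exact Finset.sum_congr rfl fun _ _ => by ring

lemma signMean_sum {ι : Type*} (t : Finset ι) (f : ι → (Fin d → ℤˣ) → ℝ) :
    signMean (fun s => ∑ i ∈ t, f i s) = ∑ i ∈ t, signMean (f i) := by
  simp only [signMean, Finset.mul_sum]
  exact Finset.sum_comm

/-- The `i`-th sign as a real number. -/
def sgn (s : Fin d → ℤˣ) (i : Fin d) : ℝ := ((s i : ℤ) : ℝ)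

lemma sgn_mul_self (s : Fin d → ℤˣ) (i : Fin d) : sgn s i * sgn s i = 1 :=
  units_cast_mul_self _

lemma sgn_flip_self (s : Fin d → ℤˣ) (k : Fin d) :
    sgn (s * Pi.mulSingle k (-1)) k = -sgn s k := by
  simp [sgn]

lemma sgn_flip_of_ne (s : Fin d → ℤˣ) {i k : Fin d} (h : i ≠ k) :
    sgn (s * Pi.mulSingle k (-1)) i = sgn s i := by
  simp [sgn, h]

lemma signMean_sgn_mul_sgn (i j : Fin d) :
    signMean (fun s => sgn s i * sgn s j) = if i = j then 1 else 0 := by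
  split_ifs with h
  · subst h; simp only [sgn_mul_self]; exact signMean_const 1
  · refine signMean_eq_zero_of_odd i fun s => ?_
    rw [sgn_flip_self, sgn_flip_of_ne _ (Ne.symm h)]; ring

/-- Flipping the sign `k` kills the mean unless `i` or `j` equals `k`; then `s k ² = 1` leaves a
second moment. -/
lemma signMean_four {k l : Fin d} (hkl : k ≠ l) (i j : Fin d) :
    signMean (fun s => sgn s i * sgn s j * (sgn s k * sgn s l))
      = (if i = k ∧ j = l then 1 else 0) + (if i = l ∧ j = k then 1 else 0) := by
  by_cases hik : i = k
  · subst hik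
    have e : (fun s => sgn s i * sgn s j * (sgn s i * sgn s l)) = fun s => sgn s j * sgn s l := by
      funext s
      rw [mul_mul_mul_comm, sgn_mul_self, one_mul]
    rw [e, signMean_sgn_mul_sgn]; simp [hkl]
  · by_cases hjk : j = k
    · subst hjk
      have e : (fun s => sgn s i * sgn s j * (sgn s j * sgn s l))
          = fun s => sgn s i * sgn s l := by
        funext s
        rw [show sgn s i * sgn s j * (sgn s j * sgn s l)
          = (sgn s j * sgn s j) * (sgn s i * sgn s l) by ring, sgn_mul_self, one_mul]
      rw [e, signMean_sgn_mul_sgn]; simp [hik]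
    · simp only [hik, hjk, false_and, and_false, if_false, add_zero]
      refine signMean_eq_zero_of_odd k fun s => ?_
      rw [sgn_flip_self, sgn_flip_of_ne _ hik, sgn_flip_of_ne _ hjk, sgn_flip_of_ne _ hkl.symm]
      ring

variable {lam : Fin d → ℝ}

lemma sum_denseLaw_mul (f : DenseDraw d → ℝ) :
    ∑ o, denseLaw lam o * f o
      = 1 / 2 * ∑ i, lam i * f (Sum.inl i) + 1 / 2 * signMean fun s => f (Sum.inr s) := by
  simp only [Fintype.sum_sum_type, denseLaw, signMean, Finset.mul_sum, mul_assoc]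

/-- Each side of the coin separately has second moment `diag lam`. -/
lemma sum_denseLaw_smul_vecMulVec (hlam : ∀ i, 0 < lam i) :
    ∑ o, denseLaw lam o • Matrix.vecMulVec (denseCoord lam o) (denseCoord lam o)
      = Matrix.diagonal lam := by
  ext k l
  simp only [Matrix.sum_apply, Matrix.smul_apply, smul_eq_mul]
  rw [sum_denseLaw_mul fun o => Matrix.vecMulVec (denseCoord lam o) (denseCoord lam o) k l]
  have e : (fun s : Fin d → ℤˣ =>
      Matrix.vecMulVec (denseCoord lam (Sum.inr s)) (denseCoord lam (Sum.inr s)) k l)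
      = fun s => (Real.sqrt (lam k) * Real.sqrt (lam l)) * (sgn s k * sgn s l) := by
    funext s
    simp only [Matrix.vecMulVec_apply, denseCoord, sgn]; ring
  rw [e, signMean_mul_left, signMean_sgn_mul_sgn]
  simp only [Matrix.vecMulVec_apply, denseCoord, Pi.single_apply, Matrix.diagonal_apply]
  by_cases h : k = l
  · subst h
    simp [Real.mul_self_sqrt (hlam k).le]; ring
  · simp [h]

/-- Dense sampling yields an unbiased estimate, in the basis of eigenvectors. -/
lemma sum_denseLaw_smul_denseEstimateCoord (hlam : ∀ i, 0 < lam i) {A : Mat d} (hA : A.IsSymm) :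
    ∑ o, denseLaw lam o •
      denseEstimateCoord lam o (denseCoord lam o ⬝ᵥ A *ᵥ denseCoord lam o) = A := by
  ext k l
  simp only [Matrix.sum_apply, Matrix.smul_apply, smul_eq_mul]
  rw [sum_denseLaw_mul fun o =>
    denseEstimateCoord lam o (denseCoord lam o ⬝ᵥ A *ᵥ denseCoord lam o) k l]
  have hs (i : Fin d) : Real.sqrt (lam i) ≠ 0 := (Real.sqrt_pos.mpr (hlam i)).ne'
  have hinv (i : Fin d) : (Real.sqrt (lam i))⁻¹ * (Real.sqrt (lam i))⁻¹ = (lam i)⁻¹ := by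
    rw [← mul_inv, Real.mul_self_sqrt (hlam i).le]
  -- After the factor `1/2` of the coin, the side `B = 1` contributes exactly the diagonal of `A`.
  have h1 : ∀ i, lam i * denseEstimateCoord lam (Sum.inl i)
      (denseCoord lam (Sum.inl i) ⬝ᵥ A *ᵥ denseCoord lam (Sum.inl i)) k l
      = if k = i ∧ l = i then 2 * A i i else 0 := by
    intro i
    have : denseCoord lam (Sum.inl i) ⬝ᵥ A *ᵥ denseCoord lam (Sum.inl i) = A i i := by
      simp [denseCoord]
    rw [this]
    simp only [denseEstimateCoord, Matrix.smul_apply, Matrix.vecMulVec_apply, Pi.single_apply,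
      smul_eq_mul]
    by_cases hk : k = i
    · by_cases hl : l = i
      · simp only [hk, hl, if_true, and_self, hinv]
        have := (hlam i).ne'
        field_simp
      · simp [hl]
    · simp [hk]
  have hquad (s : Fin d → ℤˣ) : denseCoord lam (Sum.inr s) ⬝ᵥ A *ᵥ denseCoord lam (Sum.inr s)
      = ∑ i, ∑ j, (Real.sqrt (lam i) * Real.sqrt (lam j) * A i j) * (sgn s i * sgn s j) := by
    simp only [dotProduct, Matrix.mulVec, Finset.mul_sum, denseCoord, sgn]
    exact Finset.sum_congr rfl fun i _ => Finset.sum_congr rfl fun j _ => by ring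
  simp only [h1]
  by_cases hkl : k = l
  · subst hkl
    have h2 : ∀ s : Fin d → ℤˣ, denseEstimateCoord lam (Sum.inr s)
      (denseCoord lam (Sum.inr s) ⬝ᵥ A *ᵥ denseCoord lam (Sum.inr s)) k k = 0 := by
      intro s
      simp only [denseEstimateCoord, Matrix.smul_apply, Matrix.sub_apply, Matrix.vecMulVec_apply,
        Matrix.diagonal_apply_eq, mul_mul_mul_comm _ (Real.sqrt (lam k))⁻¹, units_cast_mul_self,
        hinv]
      simp
    simp only [h2, signMean_const]
    simp
  -- Off the diagonal, the signs average to `A k l + A l k`; symmetry of `A` and the coin's `1/2`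
  -- turn this into `A k l`.
  · have h2 : (fun s : Fin d → ℤˣ => denseEstimateCoord lam (Sum.inr s)
        (denseCoord lam (Sum.inr s) ⬝ᵥ A *ᵥ denseCoord lam (Sum.inr s)) k l)
        = fun s => ∑ i, ∑ j, ((Real.sqrt (lam k))⁻¹ * (Real.sqrt (lam l))⁻¹
          * (Real.sqrt (lam i) * Real.sqrt (lam j) * A i j))
          * (sgn s i * sgn s j * (sgn s k * sgn s l)) := by
      funext s
      simp only [denseEstimateCoord, Matrix.smul_apply, Matrix.sub_apply, Matrix.vecMulVec_apply,
        Matrix.diagonal_apply_ne _ hkl, hquad, smul_eq_mul, Finset.sum_mul, sub_zero]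
      exact Finset.sum_congr rfl fun i _ => Finset.sum_congr rfl fun j _ => by
        simp only [sgn]; ring
    rw [h2, signMean_sum]
    simp only [signMean_sum, signMean_mul_left, signMean_four hkl]
    have h3 : ∀ i, ¬(k = i ∧ l = i) := fun i h => hkl (h.1.trans h.2.symm)
    simp only [mul_add, Finset.sum_add_distrib, ite_and, mul_ite, mul_one, mul_zero]
    simp only [Finset.sum_ite_irrel, Finset.sum_ite_eq', Finset.sum_const_zero, Finset.mem_univ,
      if_true]
    have h4 : ∀ x, (if k = x then if l = x then 2 * A x x else 0 else 0) = 0 := by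
      intro x; rw [← ite_and, if_neg (h3 x)]
    have h5 : A l k = A k l := hA.apply k l
    have := hs k
    have := hs l
    simp only [h4, h5, Finset.sum_const_zero]
    field_simp
    ring

variable {v : Fin d → Vec d}

lemma sum_denseLaw_smul_outer (hlam : ∀ i, 0 < lam i) :
    ∑ o, denseLaw lam o • outer (denseVector lam v o) = ofEigen lam v := by
  rw [ofEigen_eq_conjDiag, conjDiag, ← sum_denseLaw_smul_vecMulVec hlam, Finset.mul_sum,
    Finset.sum_mul]
  refine Finset.sum_congr rfl fun o _ => ?_
  rw [outer_denseVector, Matrix.mul_smul, Matrix.smul_mul]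

/-- Dense sampling yields an unbiased estimate of the loss matrix. -/
lemma sum_denseLaw_smul_denseEstimate (hv : Orthonormal ℝ v) (hlam : ∀ i, 0 < lam i)
    {L : Mat d} (hL : L.IsSymm) :
    ∑ o, denseLaw lam o • denseEstimate lam v o (iprod (outer (denseVector lam v o)) L) = L := by
  have hV' : frame v * (frame v)ᵀ = 1 := mul_eq_one_comm.mp (frame_transpose_mul hv)
  have hA : ((frame v)ᵀ * L * frame v).IsSymm := by
    simp [Matrix.IsSymm, Matrix.transpose_mul, hL.eq, Matrix.mul_assoc]
  have h := sum_denseLaw_smul_denseEstimateCoord hlam hA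
  have hl (o : DenseDraw d) : iprod (outer (denseVector lam v o)) L
      = denseCoord lam o ⬝ᵥ ((frame v)ᵀ * L * frame v) *ᵥ denseCoord lam o := by
    rw [iprod_outer, ofLp_denseVector, ← Matrix.mulVec_mulVec, ← Matrix.mulVec_mulVec,
      Matrix.dotProduct_mulVec (denseCoord lam o), Matrix.vecMul_transpose]
  calc _ = frame v * (∑ o, denseLaw lam o • denseEstimateCoord lam o
        (denseCoord lam o ⬝ᵥ ((frame v)ᵀ * L * frame v) *ᵥ denseCoord lam o)) * (frame v)ᵀ := by
        rw [Finset.mul_sum, Finset.sum_mul]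
        refine Finset.sum_congr rfl fun o _ => ?_
        rw [denseEstimate_eq hv hlam, hl, Matrix.mul_smul, Matrix.smul_mul]
    _ = (frame v * (frame v)ᵀ) * L * (frame v * (frame v)ᵀ) := by
        rw [h]; simp only [Matrix.mul_assoc]
    _ = L := by rw [hV', Matrix.one_mul, Matrix.mul_one]

end Moments

/-! ### Bounds from the spectral norm, and unit length of the played vector. -/

section Bounds

variable {d : ℕ}

lemma dotProduct_self_eq_norm_sq (w : Vec d) : w.ofLp ⬝ᵥ w.ofLp = ‖w‖ ^ 2 := by
  rw [EuclideanSpace.real_norm_sq_eq]; simp [dotProduct, sq]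

lemma abs_dotProduct_mulVec_le (L : Mat d) (x y : Vec d) :
    |x.ofLp ⬝ᵥ L *ᵥ y.ofLp| ≤ ‖x‖ * (specNorm L * ‖y‖) := by
  have h : x.ofLp ⬝ᵥ L *ᵥ y.ofLp = inner ℝ x (Matrix.toEuclideanCLM (n := Fin d) (𝕜 := ℝ) L y) := by
    rw [PiLp.inner_apply]
    simp [dotProduct, mul_comm]
  rw [h]
  exact (abs_real_inner_le_norm _ _).trans
    (mul_le_mul_of_nonneg_left (ContinuousLinearMap.le_opNorm _ _) (norm_nonneg _))

lemma abs_iprod_outer_le {L : Mat d} (hL : specNorm L ≤ 1) {w : Vec d} (hw : ‖w‖ = 1) :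
    |iprod (outer w) L| ≤ 1 := by
  rw [iprod_outer]
  have := abs_dotProduct_mulVec_le L w w
  rw [hw] at this; linarith

lemma abs_apply_le_of_specNorm_le {L : Mat d} (hL : specNorm L ≤ 1) (i j : Fin d) :
    |L i j| ≤ 1 := by
  have := abs_dotProduct_mulVec_le L (EuclideanSpace.single i 1) (EuclideanSpace.single j 1)
  simp at this
  linarith

lemma abs_trace_le_of_specNorm_le {L : Mat d} (hL : specNorm L ≤ 1) : |L.trace| ≤ d := by
  calc |L.trace| ≤ ∑ i, |L i i| := Finset.abs_sum_le_sum_abs _ _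
    _ ≤ ∑ _i : Fin d, (1 : ℝ) := Finset.sum_le_sum fun i _ => abs_apply_le_of_specNorm_le hL i i
    _ = d := by simp

variable {v : Fin d → Vec d} {lam : Fin d → ℝ}

lemma norm_denseVector (hv : Orthonormal ℝ v) (hlam : ∀ i, 0 < lam i) (hsum : ∑ i, lam i = 1)
    (o : DenseDraw d) : ‖denseVector lam v o‖ = 1 := by
  rcases o with i | s
  · exact hv.1 i
  · have h : ‖denseVector lam v (Sum.inr s)‖ ^ 2 = 1 := by
      rw [← dotProduct_self_eq_norm_sq, ofLp_denseVector, Matrix.dotProduct_mulVec,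
        ← Matrix.mulVec_transpose, Matrix.mulVec_mulVec, frame_transpose_mul hv,
        Matrix.one_mulVec, ← hsum]
      refine Finset.sum_congr rfl fun i _ => ?_
      simp only [denseCoord]
      rw [mul_mul_mul_comm, units_cast_mul_self, one_mul, Real.mul_self_sqrt (hlam i).le]
    nlinarith [norm_nonneg (denseVector lam v (Sum.inr s))]

lemma eigenvalue_pos_of_posDef (hv : Orthonormal ℝ v) (hW : (ofEigen lam v).PosDef) :
    ∀ i, 0 < lam i := by
  rw [ofEigen_eq_conjDiag] at hW
  exact pos_of_posDef_conjDiag (frame_transpose_mul hv) hW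

lemma trace_ofEigen (hv : Orthonormal ℝ v) (c : Fin d → ℝ) : (ofEigen c v).trace = ∑ i, c i := by
  rw [ofEigen_eq_conjDiag, trace_conjDiag (frame_transpose_mul hv)]

lemma trace_inv_ofEigen (hv : Orthonormal ℝ v) (hlam : ∀ i, 0 < lam i) :
    (ofEigen lam v)⁻¹.trace = ∑ i, (lam i)⁻¹ := by
  rw [ofEigen_eq_conjDiag, inv_conjDiag (frame_transpose_mul hv) fun i => (hlam i).ne',
    trace_conjDiag (frame_transpose_mul hv)]

end Bounds

/-! ### The smoothed comparator. -/

section Comparator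

variable {d : ℕ}

/-- A positive definite density matrix close to the rank-one matrix `x xᵀ`. -/
noncomputable def comparator (ε : ℝ) (x : Vec d) : Mat d :=
  (ε / d) • (1 : Mat d) + (1 - ε) • outer x

lemma initial_mem_posDensity (hd : 1 ≤ d) : (1 / (d : ℝ)) • (1 : Mat d) ∈ posDensity d := by
  have : (0 : ℝ) < d := by exact_mod_cast hd
  refine ⟨Matrix.PosDef.one.smul (by positivity), ?_⟩
  simp [this.ne']

variable {ε : ℝ} {x : Vec d}

lemma comparator_mem_posDensity (hd : 1 ≤ d) (hx : ‖x‖ = 1) (hε : 0 < ε) (hε1 : ε ≤ 1) :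
    comparator ε x ∈ posDensity d := by
  have hd' : (0 : ℝ) < d := by exact_mod_cast hd
  have hxx : x.ofLp ⬝ᵥ x.ofLp = 1 := by rw [dotProduct_self_eq_norm_sq, hx, one_pow]
  refine ⟨posDef_smul_one_add_vecMulVec (by positivity) ?_, ?_⟩
  · rw [hxx]; have : 0 < ε / d := by positivity
    linarith
  · simp only [comparator, outer, Matrix.trace_add, Matrix.trace_smul, Matrix.trace_one,
      Fintype.card_fin, Matrix.trace_vecMulVec, hxx, smul_eq_mul]
    field_simp; ring

lemma bregman_comparator_le (hd : 1 ≤ d) (hx : ‖x‖ = 1) (hε : 0 < ε) (hε1 : ε ≤ 1) :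
    bregman (comparator ε x) ((1 / (d : ℝ)) • (1 : Mat d)) ≤ -(d * Real.log ε) := by
  have hd' : (0 : ℝ) < d := by exact_mod_cast hd
  have hxx : x.ofLp ⬝ᵥ x.ofLp = 1 := by rw [dotProduct_self_eq_norm_sq, hx, one_pow]
  have hmem := comparator_mem_posDensity hd hx hε hε1
  have ha : 0 < ε / d := by positivity
  have hinv : ((1 / (d : ℝ)) • (1 : Mat d))⁻¹ = (d : ℝ) • (1 : Mat d) := by
    apply Matrix.inv_eq_right_inv
    rw [Matrix.smul_mul, Matrix.mul_smul, Matrix.mul_one, smul_smul, one_div,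
      inv_mul_cancel₀ hd'.ne', one_smul]
  -- The eigenvalues of the comparator are all at least `ε / d`. The resulting `d log d` cancels
  -- against `log det (I/d)`.
  have hdet : d * Real.log (ε / d) ≤ Real.log (comparator ε x).det := by
    rw [← Real.log_pow]
    apply Real.log_le_log (by positivity)
    rw [comparator, outer, det_smul_one_add_vecMulVec hd ha.ne', hxx]
    calc (ε / d) ^ d = (ε / d) ^ (d - 1) * (ε / d) := by
          rw [← pow_succ, Nat.sub_add_cancel hd]
      _ ≤ _ := mul_le_mul_of_nonneg_left (by linarith) (by positivity)
  rw [bregman_eq (initial_mem_posDensity hd).1, hinv, iprod_smul_left, iprod_one_left, hmem.2,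
    Matrix.det_smul, Matrix.det_one, Fintype.card_fin, mul_one, Real.log_pow, Real.log_div one_ne_zero
    hd'.ne', Real.log_one]
  rw [Real.log_div hε.ne' hd'.ne'] at hdet
  linarith

/-- The difference is `ε (I/d - x xᵀ)`, and each of the two terms pairs with `L` to at most `1` in
absolute value. -/
lemma iprod_comparator_sub_le (hd : 1 ≤ d) (hx : ‖x‖ = 1) (hε : 0 < ε) {L : Mat d}
    (hL : specNorm L ≤ 1) : iprod L (comparator ε x - outer x) ≤ 2 * ε := by
  have hd' : (0 : ℝ) < d := by exact_mod_cast hd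
  have h1 := (abs_le.mp (abs_iprod_outer_le hL hx)).1
  have h2 := (abs_le.mp (abs_trace_le_of_specNorm_le hL)).2
  have h3 : ε / d * L.trace ≤ ε := by
    calc ε / d * L.trace ≤ ε / d * d := mul_le_mul_of_nonneg_left h2 (by positivity)
      _ = ε := by field_simp
  rw [comparator, iprod_sub_right, iprod_add_right, iprod_smul_right, iprod_smul_right,
    iprod_one_right, iprod_comm L]
  nlinarith

end Comparator

/-! ### Bounded history-measurable functions and integration over a fresh draw. -/

section BoundedMeasurable

variable {Ω : Type*} {m : MeasurableSpace Ω}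

/-- Bounded measurable real functions. -/
def BddMeas (m : MeasurableSpace Ω) (f : Ω → ℝ) : Prop :=
  Measurable[m] f ∧ ∃ C, ∀ ω, |f ω| ≤ C

namespace BddMeas

variable {f g : Ω → ℝ}

lemma const (c : ℝ) : BddMeas m fun _ => c := ⟨measurable_const, |c|, fun _ => le_rfl⟩

lemma add (hf : BddMeas m f) (hg : BddMeas m g) : BddMeas m fun ω => f ω + g ω := by
  obtain ⟨hf, C, hC⟩ := hf
  obtain ⟨hg, D, hD⟩ := hg
  exact ⟨hf.add hg, C + D, fun ω => (abs_add_le _ _).trans (add_le_add (hC ω) (hD ω))⟩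

lemma mul (hf : BddMeas m f) (hg : BddMeas m g) : BddMeas m fun ω => f ω * g ω := by
  obtain ⟨hf, C, hC⟩ := hf
  obtain ⟨hg, D, hD⟩ := hg
  refine ⟨hf.mul hg, C * D, fun ω => ?_⟩
  rw [abs_mul]
  exact mul_le_mul (hC ω) (hD ω) (abs_nonneg _) ((abs_nonneg _).trans (hC ω))

lemma sub (hf : BddMeas m f) (hg : BddMeas m g) : BddMeas m fun ω => f ω - g ω := by
  have := hf.add ((const (-1)).mul hg)
  simpa [sub_eq_add_neg] using this

lemma sum {ι : Type*} (s : Finset ι) {F : ι → Ω → ℝ} (hF : ∀ i, BddMeas m (F i)) :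
    BddMeas m fun ω => ∑ i ∈ s, F i ω := by
  classical
  induction s using Finset.induction_on with
  | empty => simpa using const 0
  | insert a s ha ih => simpa [Finset.sum_insert ha] using (hF a).add ih

lemma sqrt (hf : BddMeas m f) : BddMeas m fun ω => Real.sqrt (f ω) := by
  obtain ⟨hf, C, hC⟩ := hf
  refine ⟨hf.sqrt, Real.sqrt C, fun ω => ?_⟩
  rw [abs_of_nonneg (Real.sqrt_nonneg _)]
  exact Real.sqrt_le_sqrt ((le_abs_self _).trans (hC ω))

lemma integrable {mΩ : MeasurableSpace Ω} (hm : m ≤ mΩ) {P : Measure Ω} [IsFiniteMeasure P]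
    (hf : BddMeas m f) : Integrable f P := by
  obtain ⟨hf, C, hC⟩ := hf
  exact Integrable.of_bound (hf.mono hm le_rfl).aestronglyMeasurable C (Filter.Eventually.of_forall hC)

variable {d : ℕ} {A B : Ω → Mat d}

lemma matrix_mul (hA : ∀ i j, BddMeas m fun ω => A ω i j) (hB : ∀ i j, BddMeas m fun ω => B ω i j)
    (i j : Fin d) : BddMeas m fun ω => (A ω * B ω) i j := by
  simp only [Matrix.mul_apply]
  exact sum _ fun k => (hA i k).mul (hB k j)

lemma iprod (hA : ∀ i j, BddMeas m fun ω => A ω i j) (hB : ∀ i j, BddMeas m fun ω => B ω i j) :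
    BddMeas m fun ω => BanditPCA.iprod (A ω) (B ω) := by
  simp only [iprod_eq_sum]
  exact sum _ fun i => sum _ fun j => (hA j i).mul (hB j i)

variable {v : Ω → Fin d → Vec d} {lam : Ω → Fin d → ℝ}

lemma outer_denseVector (hv : ∀ i j, BddMeas m fun ω => v ω i j)
    (hlam : ∀ i, BddMeas m fun ω => lam ω i) (o : DenseDraw d) (i j : Fin d) :
    BddMeas m fun ω => outer (denseVector (lam ω) (v ω) o) i j := by
  have h : ∀ k, BddMeas m fun ω => (denseVector (lam ω) (v ω) o).ofLp k := by
    intro k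
    rcases o with a | s
    · exact hv a k
    · simp only [denseVector, WithLp.ofLp_sum, WithLp.ofLp_smul, Finset.sum_apply, Pi.smul_apply,
        smul_eq_mul]
      exact sum _ fun a => ((const _).mul (hlam a).sqrt).mul (hv a k)
  exact (h i).mul (h j)

lemma ofEigen (hv : ∀ i j, BddMeas m fun ω => v ω i j)
    (hlam : ∀ i, BddMeas m fun ω => lam ω i) (i j : Fin d) :
    BddMeas m fun ω => BanditPCA.ofEigen (lam ω) (v ω) i j := by
  simp only [BanditPCA.ofEigen, Matrix.sum_apply, Matrix.smul_apply, smul_eq_mul]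
  exact sum _ fun k => (hlam k).mul ((hv k i).mul (hv k j))

/-- The estimate involves `1 / lam` and `1 / √lam`, so boundedness is required of the inverse
eigenvalues. -/
lemma denseEstimate (hv : ∀ i j, BddMeas m fun ω => v ω i j)
    (hinv : ∀ i, BddMeas m fun ω => (lam ω i)⁻¹) (hort : ∀ ω, Orthonormal ℝ (v ω))
    (hpos : ∀ ω i, 0 < lam ω i) (hf : BddMeas m f) (o : DenseDraw d) (i j : Fin d) :
    BddMeas m fun ω => BanditPCA.denseEstimate (lam ω) (v ω) o (f ω) i j := by
  simp only [denseEstimate_eq (hort _) (hpos _)]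
  have hF : ∀ i j, BddMeas m fun ω => frame (v ω) i j := fun i j => hv j i
  have hF' : ∀ i j, BddMeas m fun ω => (frame (v ω))ᵀ i j := fun i j => hv i j
  refine matrix_mul (matrix_mul hF fun k l => ?_) hF' i j
  have hr : ∀ i, BddMeas m fun ω => (Real.sqrt (lam ω i))⁻¹ := by
    intro i; simpa only [Real.sqrt_inv] using (hinv i).sqrt
  rcases o with a | s
  · simp only [denseEstimateCoord, Matrix.smul_apply, Matrix.vecMulVec_apply, smul_eq_mul,
      Pi.single_apply]
    have h1 : ∀ k, BddMeas m fun ω => if k = a then (Real.sqrt (lam ω a))⁻¹ else 0 := by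
      intro k; split_ifs
      · exact hr a
      · exact const 0
    exact ((const 2).mul hf).mul ((h1 k).mul (h1 l))
  · simp only [denseEstimateCoord, Matrix.smul_apply, Matrix.sub_apply, Matrix.vecMulVec_apply,
      Matrix.diagonal_apply, smul_eq_mul]
    have h1 : BddMeas m fun ω => if k = l then (lam ω k)⁻¹ else 0 := by
      split_ifs
      · exact hinv k
      · exact const 0
    exact hf.mul ((((const _).mul (hr k)).mul ((const _).mul (hr l))).sub h1)

end BddMeas

/-- Integrating a function of the history and of a fresh draw. -/
lemma integral_draw {mΩ : MeasurableSpace Ω} (hm : m ≤ mΩ) {P : Measure Ω} [IsFiniteMeasure P]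
    {O : Type*} [Fintype O] {D : Ω → O} (hD : ∀ o, MeasurableSet {ω | D ω = o})
    {q : O → Ω → ℝ}
    (hq : ∀ o, P[Set.indicator {ω | D ω = o} (fun _ => (1 : ℝ)) | m] =ᵐ[P] q o)
    {F : O → Ω → ℝ} (hF : ∀ o, BddMeas m (F o)) :
    Integrable (fun ω => F (D ω) ω) P ∧
      ∫ ω, F (D ω) ω ∂P = ∫ ω, ∑ o, q o ω * F o ω ∂P := by
  classical
  have hdec : (fun ω => F (D ω) ω)
      = fun ω => ∑ o, (Set.indicator {ω | D ω = o} (fun _ => (1 : ℝ)) * F o) ω := by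
    funext ω
    simp [Set.indicator_apply]
  have hI (o : O) : Integrable (Set.indicator {ω | D ω = o} fun _ => (1 : ℝ)) P :=
    (integrable_const 1).indicator (hD o)
  have hIF (o : O) : Integrable (Set.indicator {ω | D ω = o} (fun _ => (1 : ℝ)) * F o) P := by
    obtain ⟨h1, C, hC⟩ := hF o
    exact (hI o).mul_bdd (h1.mono hm le_rfl).aestronglyMeasurable (Filter.Eventually.of_forall hC)
  -- `F o` is measurable with respect to the history, so it can be pulled out of the conditional
  -- expectation.
  have hae (o : O) : P[Set.indicator {ω | D ω = o} (fun _ => (1 : ℝ)) * F o | m]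
      =ᵐ[P] fun ω => q o ω * F o ω :=
    (condExp_mul_of_stronglyMeasurable_right (hF o).1.stronglyMeasurable (hIF o) (hI o)).trans
      ((hq o).mul (ae_eq_refl (F o)))
  rw [hdec]
  refine ⟨integrable_finsetSum _ fun o _ => hIF o, ?_⟩
  rw [integral_finsetSum _ fun o _ => hIF o,
    integral_finsetSum _ fun o _ => integrable_condExp.congr (hae o)]
  refine Finset.sum_congr rfl fun o _ => ?_
  rw [← integral_congr_ae (hae o), integral_condExp hm]

end BoundedMeasurable

/-! ### Pathwise properties of a run. -/

namespace Play

variable {d : ℕ} {Ω : Type*} {X : Play d Ω}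

lemma weights_zero (t : ℕ) (ω : Ω) : X.weights 0 t ω = X.eigval t ω := by
  funext i; simp [weights]

lemma isSymm_estimate (t : ℕ) (ω : Ω) : (X.estimate 0 t ω).IsSymm :=
  isSymm_denseEstimate _ _ _ _

lemma observed_eq (t : ℕ) (ω : Ω) : X.observed 0 t ω
    = iprod (outer (denseVector (X.eigval t ω) (X.eigvec t ω) (X.draw t ω))) (X.loss t ω) := by
  rw [observed, action, weights_zero]

lemma estimate_eq (t : ℕ) (ω : Ω) : X.estimate 0 t ω
    = denseEstimate (X.eigval t ω) (X.eigvec t ω) (X.draw t ω) (X.observed 0 t ω) := by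
  rw [estimate, weights_zero]

lemma isUpdate_of_posDef (hd : 1 ≤ d) {η : ℝ} {t : ℕ} {ω : Ω} (h : (X.iterate η 0 t ω).PosDef) :
    IsUpdate η (X.iterate η 0 t ω) (X.estimate 0 t ω) (X.iterate η 0 (t + 1) ω) :=
  isUpdate_update hd η h (isSymm_estimate t ω)

lemma iterate_mem (hd : 1 ≤ d) (η : ℝ) (t : ℕ) (ω : Ω) : X.iterate η 0 t ω ∈ posDensity d := by
  induction t with
  | zero => exact initial_mem_posDensity hd
  | succ t ih => exact (isUpdate_of_posDef hd ih.1).1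

lemma isUpdate_iterate (hd : 1 ≤ d) (η : ℝ) (t : ℕ) (ω : Ω) :
    IsUpdate η (X.iterate η 0 t ω) (X.estimate 0 t ω) (X.iterate η 0 (t + 1) ω) :=
  isUpdate_of_posDef hd (iterate_mem hd η t ω).1

namespace IsRun

variable [mΩ : MeasurableSpace Ω] {P : Measure Ω} {𝓕 : Filtration ℕ mΩ} {T : ℕ} {η : ℝ}

lemma orthonormal (hX : X.IsRun P 𝓕 T η 0) {t : ℕ} (ht : t < T) (ω : Ω) :
    Orthonormal ℝ (X.eigvec t ω) := (hX.eigen t ht ω).1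

lemma iterate_eq (hX : X.IsRun P 𝓕 T η 0) {t : ℕ} (ht : t < T) (ω : Ω) :
    X.iterate η 0 t ω = ofEigen (X.eigval t ω) (X.eigvec t ω) := (hX.eigen t ht ω).2

lemma eigval_pos (hX : X.IsRun P 𝓕 T η 0) (hd : 1 ≤ d) {t : ℕ} (ht : t < T) (ω : Ω) (i : Fin d) :
    0 < X.eigval t ω i := by
  refine eigenvalue_pos_of_posDef (hX.orthonormal ht ω) ?_ i
  rw [← hX.iterate_eq ht]; exact (iterate_mem hd η t ω).1

lemma sum_eigval (hX : X.IsRun P 𝓕 T η 0) (hd : 1 ≤ d) {t : ℕ} (ht : t < T) (ω : Ω) :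
    ∑ i, X.eigval t ω i = 1 := by
  rw [← trace_ofEigen (hX.orthonormal ht ω), ← hX.iterate_eq ht]
  exact (iterate_mem hd η t ω).2

lemma norm_action (hX : X.IsRun P 𝓕 T η 0) (hd : 1 ≤ d) {t : ℕ} (ht : t < T) (ω : Ω) :
    ‖X.action 0 t ω‖ = 1 := by
  rw [action, weights_zero]
  exact norm_denseVector (hX.orthonormal ht ω) (hX.eigval_pos hd ht ω) (hX.sum_eigval hd ht ω) _

lemma abs_observed_le (hX : X.IsRun P 𝓕 T η 0) (hd : 1 ≤ d) {t : ℕ} (ht : t < T) (ω : Ω) :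
    |X.observed 0 t ω| ≤ 1 :=
  abs_iprod_outer_le (hX.loss_norm t ht ω) (hX.norm_action hd ht ω)

lemma posDef_inv_add (hX : X.IsRun P 𝓕 T η 0) (hd : 2 ≤ d) (hη : 0 < η)
    (hηd : η ≤ 1 / (2 * (d : ℝ))) {t : ℕ} (ht : t < T) (ω : Ω) :
    ((X.iterate η 0 t ω)⁻¹ + η • X.estimate 0 t ω).PosDef ∧
      η * iprod (X.estimate 0 t ω) (X.iterate η 0 t ω)
        - Real.log (((X.iterate η 0 t ω)⁻¹ + η • X.estimate 0 t ω).det * (X.iterate η 0 t ω).det)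
      ≤ η ^ 2 * ((d : ℝ) ^ 2 + 1) * X.observed 0 t ω ^ 2 := by
  rw [hX.iterate_eq ht, estimate_eq]
  exact dense_local_bound hd (hX.orthonormal ht ω) (hX.eigval_pos (by omega) ht ω) hη hηd
    (hX.abs_observed_le (by omega) ht ω) _

/-- The bound `K` may depend on `t` but not on `ω`. It only provides integrability and does not
enter the regret bound. -/
lemma exists_trace_inv_le (hX : X.IsRun P 𝓕 T η 0) (hd : 2 ≤ d) (hη : 0 < η)
    (hηd : η ≤ 1 / (2 * (d : ℝ))) {t : ℕ} (ht : t ≤ T) :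
    ∃ K : ℝ, ∀ ω, (X.iterate η 0 t ω)⁻¹.trace ≤ K := by
  induction t with
  | zero => exact ⟨((1 / (d : ℝ)) • (1 : Mat d))⁻¹.trace, fun _ => le_rfl⟩
  | succ t ih =>
    obtain ⟨K, hK⟩ := ih (by omega)
    have ht' : t < T := ht
    refine ⟨K + η * (2 * K) + (d : ℝ) ^ 2, fun ω => ?_⟩
    have h1 := (isUpdate_iterate (X := X) (by omega) η t ω).trace_inv_le
      (hX.posDef_inv_add hd hη hηd ht' ω).1
    have h2 := trace_denseEstimate_le (hX.orthonormal ht' ω) (hX.eigval_pos (by omega) ht' ω)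
      (hX.abs_observed_le (by omega) ht' ω) (X.draw t ω)
    rw [← estimate_eq, ← hX.iterate_eq ht'] at h2
    have h3 := mul_le_mul_of_nonneg_left (h2.trans (mul_le_mul_of_nonneg_left (hK ω) zero_le_two))
      hη.le
    linarith [hK ω]

lemma bddMeas_eigval (hX : X.IsRun P 𝓕 T η 0) (hd : 1 ≤ d) {t : ℕ} (ht : t < T) (i : Fin d) :
    BddMeas (𝓕 t) fun ω => X.eigval t ω i := by
  refine ⟨hX.eigval_meas t ht i, 1, fun ω => ?_⟩
  rw [abs_of_pos (hX.eigval_pos hd ht ω i), ← hX.sum_eigval hd ht ω]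
  exact Finset.single_le_sum (fun j _ => (hX.eigval_pos hd ht ω j).le) (Finset.mem_univ i)

lemma bddMeas_inv_eigval (hX : X.IsRun P 𝓕 T η 0) (hd : 2 ≤ d) (hη : 0 < η)
    (hηd : η ≤ 1 / (2 * (d : ℝ))) {t : ℕ} (ht : t < T) (i : Fin d) :
    BddMeas (𝓕 t) fun ω => (X.eigval t ω i)⁻¹ := by
  obtain ⟨K, hK⟩ := hX.exists_trace_inv_le hd hη hηd ht.le
  refine ⟨(hX.eigval_meas t ht i).inv, K, fun ω => ?_⟩
  have hpos := hX.eigval_pos (by omega) ht ω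
  rw [abs_of_pos (inv_pos.mpr (hpos i))]
  refine le_trans ?_ (hK ω)
  rw [hX.iterate_eq ht, trace_inv_ofEigen (hX.orthonormal ht ω) hpos]
  exact Finset.single_le_sum (f := fun j => (X.eigval t ω j)⁻¹)
    (fun j _ => (inv_pos.mpr (hpos j)).le) (Finset.mem_univ i)

lemma bddMeas_eigvec (hX : X.IsRun P 𝓕 T η 0) {t : ℕ} (ht : t < T) (i j : Fin d) :
    BddMeas (𝓕 t) fun ω => X.eigvec t ω i j := by
  refine ⟨hX.eigvec_meas t ht i j, 1, fun ω => ?_⟩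
  have := PiLp.norm_apply_le (X.eigvec t ω i) j
  rwa [(hX.orthonormal ht ω).1 i] at this

lemma bddMeas_loss (hX : X.IsRun P 𝓕 T η 0) {t : ℕ} (ht : t < T) (i j : Fin d) :
    BddMeas (𝓕 t) fun ω => X.loss t ω i j :=
  ⟨hX.loss_meas t ht i j, 1, fun ω => abs_apply_le_of_specNorm_le (hX.loss_norm t ht ω) i j⟩

/-- `update` is a choice function, so measurability is read off from the measurable
eigendecomposition instead. -/
lemma bddMeas_iterate (hX : X.IsRun P 𝓕 T η 0) (hd : 1 ≤ d) {t : ℕ} (ht : t < T) (i j : Fin d) :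
    BddMeas (𝓕 t) fun ω => X.iterate η 0 t ω i j := by
  simp only [hX.iterate_eq ht]
  exact BddMeas.ofEigen (hX.bddMeas_eigvec ht) (hX.bddMeas_eigval hd ht) i j

/-- The loss that round `t` would have under the draw `o` is a bounded function of the history. -/
lemma bddMeas_iprod_outer (hX : X.IsRun P 𝓕 T η 0) (hd : 1 ≤ d) {t : ℕ} (ht : t < T)
    (o : DenseDraw d) : BddMeas (𝓕 t) fun ω =>
      iprod (outer (denseVector (X.eigval t ω) (X.eigvec t ω) o)) (X.loss t ω) :=
  BddMeas.iprod (BddMeas.outer_denseVector (hX.bddMeas_eigvec ht) (hX.bddMeas_eigval hd ht) o)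
    (hX.bddMeas_loss ht)

lemma integral_draw [IsProbabilityMeasure P] (hX : X.IsRun P 𝓕 T η 0) {t : ℕ} (ht : t < T)
    {F : DenseDraw d → Ω → ℝ} (hF : ∀ o, BddMeas (𝓕 t) (F o)) :
    Integrable (fun ω => F (X.draw t ω) ω) P ∧
      ∫ ω, F (X.draw t ω) ω ∂P = ∫ ω, ∑ o, denseLaw (X.eigval t ω) o * F o ω ∂P := by
  refine BanditPCA.integral_draw (𝓕.le t) (fun o => 𝓕.le _ _ (hX.draw_meas t ht o))
    (q := fun o ω => denseLaw (X.eigval t ω) o) (fun o => ?_) hF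
  have := hX.draw_law t ht o
  simpa only [weights_zero] using this

/-- In dimension one every unit vector has the same rank-one matrix. The case is separate because
`|2 η l|` may reach `1` there, beyond the range of `neg_log_one_add_le`. -/
lemma regretAgainst_eq_zero_of_dim_one {X : Play 1 Ω} (hX : X.IsRun P 𝓕 T η 0) {x : Vec 1}
    (hx : ‖x‖ = 1) : X.regretAgainst P 0 T x = 0 := by
  have houter {w : Vec 1} (hw : ‖w‖ = 1) : outer w = 1 := by
    have h := dotProduct_self_eq_norm_sq w
    rw [hw] at h
    ext i j
    rw [Subsingleton.elim i 0, Subsingleton.elim j 0]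
    simpa [outer, Matrix.vecMulVec_apply, dotProduct] using h
  refine Finset.sum_eq_zero fun t ht => ?_
  rw [Finset.mem_range] at ht
  simp only [houter hx, houter (hX.norm_action le_rfl ht _), sub_self]
  simp [BanditPCA.iprod]

/-- The pathwise guarantee of mirror descent for the estimated losses. -/
lemma sum_iprod_estimate_le (hX : X.IsRun P 𝓕 T η 0) (hd : 2 ≤ d) (hη : 0 < η)
    (hηd : η ≤ 1 / (2 * (d : ℝ))) {U : Mat d} (hU : U ∈ posDensity d) (ω : Ω) :
    ∑ t ∈ Finset.range T, η * iprod (X.estimate 0 t ω) (X.iterate η 0 t ω - U)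
      ≤ bregman U ((1 / (d : ℝ)) • (1 : Mat d))
        + ∑ t ∈ Finset.range T, η ^ 2 * ((d : ℝ) ^ 2 + 1) * X.observed 0 t ω ^ 2 := by
  have hd1 : 1 ≤ d := by omega
  calc _ ≤ ∑ t ∈ Finset.range T,
        ((bregman U (X.iterate η 0 t ω) - bregman U (X.iterate η 0 (t + 1) ω))
          + η ^ 2 * ((d : ℝ) ^ 2 + 1) * X.observed 0 t ω ^ 2) := by
        refine Finset.sum_le_sum fun t ht => ?_
        have h := hX.posDef_inv_add hd hη hηd (Finset.mem_range.mp ht) ω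
        have := (isUpdate_iterate (X := X) hd1 η t ω).bregman_le (iterate_mem hd1 η t ω).1 h.1 hU
        linarith [h.2]
    _ ≤ _ := by
        -- The divergences telescope, and the last one is dropped as nonnegative.
        rw [Finset.sum_add_distrib,
          Finset.sum_range_sub' fun t => bregman U (X.iterate η 0 t ω)]
        have := bregman_nonneg hU.1 (iterate_mem (X := X) hd1 η T ω).1
        have e : X.iterate η 0 0 ω = (1 / (d : ℝ)) • (1 : Mat d) := rfl
        rw [e]; linarith

/-! ### Expectations and the regret. -/

variable [IsProbabilityMeasure P]

lemma integrable_observed_sq (hX : X.IsRun P 𝓕 T η 0) (hd : 1 ≤ d) {t : ℕ} (ht : t < T) :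
    Integrable (fun ω => X.observed 0 t ω ^ 2) P := by
  have := (hX.integral_draw ht (F := fun o ω =>
    iprod (outer (denseVector (X.eigval t ω) (X.eigvec t ω) o)) (X.loss t ω)
      * iprod (outer (denseVector (X.eigval t ω) (X.eigvec t ω) o)) (X.loss t ω))
    fun o => (hX.bddMeas_iprod_outer hd ht o).mul (hX.bddMeas_iprod_outer hd ht o)).1
  simpa only [observed_eq, sq] using this

lemma integrable_observed (hX : X.IsRun P 𝓕 T η 0) (hd : 1 ≤ d) {t : ℕ} (ht : t < T) :
    Integrable (fun ω => X.observed 0 t ω) P := by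
  simpa only [observed_eq] using (hX.integral_draw ht (hX.bddMeas_iprod_outer hd ht)).1

lemma integrable_iprod_loss (hX : X.IsRun P 𝓕 T η 0) {t : ℕ} (ht : t < T) (A : Mat d) :
    Integrable (fun ω => iprod (X.loss t ω) A) P :=
  (BddMeas.iprod (B := fun _ => A) (hX.bddMeas_loss ht) fun i j =>
    BddMeas.const (A i j)).integrable (𝓕.le t)

lemma integrable_iprod_loss_iterate (hX : X.IsRun P 𝓕 T η 0) (hd : 1 ≤ d) {t : ℕ} (ht : t < T) :
    Integrable (fun ω => iprod (X.loss t ω) (X.iterate η 0 t ω)) P :=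
  (BddMeas.iprod (hX.bddMeas_loss ht) (hX.bddMeas_iterate hd ht)).integrable (𝓕.le t)

/-- The played vector has conditional second moment `W_t`. -/
lemma integral_observed (hX : X.IsRun P 𝓕 T η 0) (hd : 1 ≤ d) {t : ℕ} (ht : t < T) :
    ∫ ω, X.observed 0 t ω ∂P = ∫ ω, iprod (X.loss t ω) (X.iterate η 0 t ω) ∂P := by
  simp only [observed_eq]
  rw [(hX.integral_draw ht (hX.bddMeas_iprod_outer hd ht)).2]
  congr 1; funext ω
  rw [hX.iterate_eq ht, ← sum_denseLaw_smul_outer (hX.eigval_pos hd ht ω), iprod_comm,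
    iprod_sum_left]
  simp only [iprod_smul_left]

/-- The loss estimates are unbiased. -/
lemma integral_estimate (hX : X.IsRun P 𝓕 T η 0) (hd : 2 ≤ d) (hη : 0 < η)
    (hηd : η ≤ 1 / (2 * (d : ℝ))) {t : ℕ} (ht : t < T) (U : Mat d) :
    Integrable (fun ω => iprod (X.estimate 0 t ω) (X.iterate η 0 t ω - U)) P ∧
      ∫ ω, iprod (X.estimate 0 t ω) (X.iterate η 0 t ω - U) ∂P
        = ∫ ω, iprod (X.loss t ω) (X.iterate η 0 t ω - U) ∂P := by
  have hd1 : 1 ≤ d := by omega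
  have h := hX.integral_draw ht (F := fun o ω => iprod (denseEstimate (X.eigval t ω) (X.eigvec t ω) o
      (iprod (outer (denseVector (X.eigval t ω) (X.eigvec t ω) o)) (X.loss t ω)))
      (X.iterate η 0 t ω - U)) fun o =>
    BddMeas.iprod (BddMeas.denseEstimate (hX.bddMeas_eigvec ht) (hX.bddMeas_inv_eigval hd hη hηd ht)
      (hX.orthonormal ht) (hX.eigval_pos hd1 ht) (hX.bddMeas_iprod_outer hd1 ht o) o)
      fun i j => (hX.bddMeas_iterate hd1 ht i j).sub (BddMeas.const (U i j))
  simp only [estimate_eq, observed_eq]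
  refine ⟨h.1, h.2.trans ?_⟩
  congr 1; funext ω
  conv_rhs => rw [← sum_denseLaw_smul_denseEstimate (hX.orthonormal ht ω) (hX.eigval_pos hd1 ht ω)
    (hX.loss_symm t ht ω), iprod_sum_left]
  simp only [iprod_smul_left]

lemma regretAgainst_eq (hX : X.IsRun P 𝓕 T η 0) (hd : 1 ≤ d) (x : Vec d) :
    X.regretAgainst P 0 T x = ∑ t ∈ Finset.range T,
      (∫ ω, X.observed 0 t ω ∂P - ∫ ω, iprod (X.loss t ω) (outer x) ∂P) := by
  refine Finset.sum_congr rfl fun t ht => ?_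
  rw [Finset.mem_range] at ht
  rw [← integral_sub (hX.integrable_observed hd ht) (hX.integrable_iprod_loss ht _)]
  congr 1; funext ω
  rw [iprod_sub_left, iprod_comm (outer x)]; rfl

/-- The regret against `x` is a constant minus a quadratic form in `x` with coefficients the
expected losses. Compactness of the sphere then yields the maximum. -/
lemma continuous_regretAgainst (hX : X.IsRun P 𝓕 T η 0) (hd : 1 ≤ d) :
    Continuous (X.regretAgainst P 0 T) := by
  have h : X.regretAgainst P 0 T = fun x => ∑ t ∈ Finset.range T,
      (∫ ω, X.observed 0 t ω ∂P - ∑ i, ∑ j, (∫ ω, X.loss t ω j i ∂P) * (x.ofLp j * x.ofLp i)) := by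
    funext x
    rw [hX.regretAgainst_eq hd]
    refine Finset.sum_congr rfl fun t ht => ?_
    rw [Finset.mem_range] at ht
    have hint (i j : Fin d) : Integrable (fun ω => X.loss t ω j i * outer x j i) P :=
      ((hX.bddMeas_loss ht j i).mul (BddMeas.const _)).integrable (𝓕.le t)
    simp only [iprod_eq_sum]
    rw [integral_finsetSum _ fun i _ => integrable_finsetSum _ fun j _ => hint i j]
    congr 1
    refine Finset.sum_congr rfl fun i _ => ?_
    rw [integral_finsetSum _ fun j _ => hint i j]
    refine Finset.sum_congr rfl fun j _ => ?_
    rw [integral_mul_const]; rfl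
  rw [h]
  fun_prop

lemma isGreatest_regret (hX : X.IsRun P 𝓕 T η 0) (hd : 1 ≤ d) :
    IsGreatest (X.regretAgainst P 0 T '' {x | ‖x‖ = 1}) (X.regret P 0 T) := by
  have hs : {x : Vec d | ‖x‖ = 1} = Metric.sphere 0 1 := by ext; simp
  refine IsCompact.isGreatest_sSup ?_ ?_
  · rw [hs]; exact (isCompact_sphere _ _).image (hX.continuous_regretAgainst hd)
  · exact Set.Nonempty.image _ ⟨EuclideanSpace.single ⟨0, hd⟩ 1, by simp⟩

lemma regretAgainst_le (hX : X.IsRun P 𝓕 T η 0) (hd : 2 ≤ d) (hη : 0 < η)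
    (hηd : η ≤ 1 / (2 * (d : ℝ))) (hT : 1 ≤ T) {x : Vec d} (hx : ‖x‖ = 1) :
    X.regretAgainst P 0 T x ≤ d * Real.log T / η
      + η * ((d : ℝ) ^ 2 + 1) * ∑ t ∈ Finset.range T, ∫ ω, X.observed 0 t ω ^ 2 ∂P + 2 := by
  have hd1 : 1 ≤ d := by omega
  have hT' : (1 : ℝ) ≤ T := by exact_mod_cast hT
  -- With `ε = 1/T` the smoothing costs `2 ε` in each of `T` rounds, hence `2`, and `-d log ε = d
  -- log T`.
  set ε : ℝ := (T : ℝ)⁻¹ with hε_def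
  have hε : 0 < ε := by positivity
  have hε1 : ε ≤ 1 := inv_le_one_of_one_le₀ hT'
  set U := comparator ε x
  have hU : U ∈ posDensity d := comparator_mem_posDensity hd1 hx hε hε1
  have hZ {t : ℕ} (ht : t ∈ Finset.range T) :=
    hX.integral_estimate hd hη hηd (Finset.mem_range.mp ht) U
  have hround : X.regretAgainst P 0 T x ≤ ∑ t ∈ Finset.range T,
      (∫ ω, iprod (X.estimate 0 t ω) (X.iterate η 0 t ω - U) ∂P + 2 * ε) := by
    rw [hX.regretAgainst_eq hd1]
    refine Finset.sum_le_sum fun t ht => ?_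
    have ht' := Finset.mem_range.mp ht
    have hle : ∫ ω, iprod (X.loss t ω) (U - outer x) ∂P ≤ 2 * ε := by
      calc _ ≤ ∫ _ω, 2 * ε ∂P :=
            integral_mono (hX.integrable_iprod_loss ht' _) (integrable_const _) fun ω =>
              iprod_comparator_sub_le hd1 hx hε (hX.loss_norm t ht' ω)
        _ = 2 * ε := by simp
    rw [(hZ ht).2, hX.integral_observed hd1 ht']
    simp only [iprod_sub_right] at hle ⊢
    rw [integral_sub (hX.integrable_iprod_loss ht' _) (hX.integrable_iprod_loss ht' _)] at hle
    rw [integral_sub (hX.integrable_iprod_loss_iterate hd1 ht') (hX.integrable_iprod_loss ht' _)]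
    linarith
  have hpath : η * ∑ t ∈ Finset.range T, ∫ ω, iprod (X.estimate 0 t ω) (X.iterate η 0 t ω - U) ∂P
      ≤ d * Real.log T + η ^ 2 * ((d : ℝ) ^ 2 + 1)
        * ∑ t ∈ Finset.range T, ∫ ω, X.observed 0 t ω ^ 2 ∂P := by
    have hsq {t : ℕ} (ht : t ∈ Finset.range T) :=
      (hX.integrable_observed_sq hd1 (Finset.mem_range.mp ht)).const_mul
        (η ^ 2 * ((d : ℝ) ^ 2 + 1))
    have hB := bregman_comparator_le hd1 hx hε hε1
    rw [hε_def, Real.log_inv, mul_neg, neg_neg] at hB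
    have hsum := integral_mono
      (integrable_finsetSum _ fun t ht => (hZ ht).1.const_mul η)
      ((integrable_const _).add (integrable_finsetSum _ fun t ht => hsq ht))
      (hX.sum_iprod_estimate_le hd hη hηd hU)
    rw [integral_finsetSum _ fun t ht => (hZ ht).1.const_mul η,
      integral_add' (integrable_const _) (integrable_finsetSum _ fun t ht => hsq ht),
      integral_finsetSum _ fun t ht => hsq ht] at hsum
    simp only [integral_const_mul, integral_const, probReal_univ, one_smul,
      ← Finset.mul_sum] at hsum
    linarith
  rw [Finset.sum_add_distrib, Finset.sum_const, Finset.card_range, nsmul_eq_mul] at hround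
  have hTε : (T : ℝ) * (2 * ε) = 2 := by rw [hε_def]; field_simp
  rw [hTε] at hround
  refine hround.trans ?_
  have e : (d : ℝ) * Real.log T / η + η * ((d : ℝ) ^ 2 + 1)
      * ∑ t ∈ Finset.range T, ∫ ω, X.observed 0 t ω ^ 2 ∂P
      = (d * Real.log T + η ^ 2 * ((d : ℝ) ^ 2 + 1)
        * ∑ t ∈ Finset.range T, ∫ ω, X.observed 0 t ω ^ 2 ∂P) / η := by
    field_simp
  rw [e]
  gcongr
  rw [le_div_iff₀ hη]
  linarith

end IsRun

end Play

end BanditPCA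

theorem theorem1 {d : ℕ} (hd : 1 ≤ d) {Ω : Type*} [mΩ : MeasurableSpace Ω]
    (P : MeasureTheory.Measure Ω) [MeasureTheory.IsProbabilityMeasure P]
    (𝓕 : MeasureTheory.Filtration ℕ mΩ)
    (T : ℕ) (η : ℝ) (hη : 0 < η) (hηd : η ≤ 1 / (2 * (d : ℝ)))
    (X : BanditPCA.Play d Ω) (hX : X.IsRun P 𝓕 T η 0) :
    -- the updates are well defined, and they are steps of online mirror descent
    (∀ t < T, ∀ ω,
      BanditPCA.IsUpdate η (X.iterate η 0 t ω) (X.estimate 0 t ω) (X.iterate η 0 (t + 1) ω) ∧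
      BanditPCA.IsMirrorDescentStep η (X.iterate η 0 t ω) (X.estimate 0 t ω)
        (X.iterate η 0 (t + 1) ω)) ∧
    -- the maximum that defines the regret is attained
    IsGreatest (X.regretAgainst P 0 T '' {x | ‖x‖ = 1}) (X.regret P 0 T) ∧
    -- the regret bound
    X.regret P 0 T ≤ d * Real.log T / η
      + η * ((d : ℝ) ^ 2 + 1) * ∑ t ∈ Finset.range T, ∫ ω, X.observed 0 t ω ^ 2 ∂P + 2 := by
  refine ⟨fun t _ ω => ?_, hX.isGreatest_regret hd, ?_⟩
  · have h := BanditPCA.Play.isUpdate_iterate (X := X) hd η t ω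
    exact ⟨h, h.isMirrorDescentStep (BanditPCA.Play.iterate_mem hd η t ω).1⟩
  · obtain ⟨x, hx, hxe⟩ := (hX.isGreatest_regret hd).1
    rw [← hxe]
    have hlog : 0 ≤ Real.log T := Real.log_natCast_nonneg T
    have hsum : 0 ≤ ∑ t ∈ Finset.range T, ∫ ω, X.observed 0 t ω ^ 2 ∂P :=
      Finset.sum_nonneg fun t _ => MeasureTheory.integral_nonneg fun ω => sq_nonneg _
    rcases Nat.eq_zero_or_pos T with rfl | hT
    -- For `T = 0` the regret is an empty sum and `Real.log 0 = 0`, so the claim is `0 ≤ 2`.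
    · simp [BanditPCA.Play.regretAgainst]
    · rcases hd.eq_or_lt with rfl | hd2
      · rw [hX.regretAgainst_eq_zero_of_dim_one hx]
        positivity
      · exact hX.regretAgainst_le hd2 hη hηd hT hx
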